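/- **Theorem (duality of sliced-regularized optimal transport).** Let $X,Y$ be Polish spaces, $\mu\in\mathcal P(X)$, $\nu\in\mathcal P(Y)$, $c:X\times Y\to[0,\infty)$ measurable, $\varepsilon>0$ and $\gamma\in[0,1]$. Let $\sigma$ be a probability measure on a measurable space $\Theta$, and let $p:\Theta\times X\to\mathbb R$ and $q:\Theta\times Y\to\mathbb R$ be measurable (the projections; write $p_\theta=p(\theta,\cdot)$, $q_\theta=q(\theta,\cdot)$). For $\theta\in\Theta$ let $\underline\pi_\theta=(F^{-1}_{p_\theta\sharp\mu},F^{-1}_{q_\theta\sharp\nu})\sharp\,\mathcal U([0,1])$ be the one-dimensional monotone plan given by the quantile functions, and let $\pi_\theta=\int \mu(\cdot\mid p_\theta=t_1)\otimes\nu(\cdot\mid q_\theta=t_2)\,\mathrm d\underline\pi_\theta(t_1,t_2)$ be its lift to $X\times Y$. Let $\xi=(1-\gamma)\,\mathbb E_{\theta\sim\sigma}[\pi_\theta]+\gamma\,\mu\otimes\nu$ be the (smoothed, if $\gamma>0$) sliced optimal transport plan. Let $\Pi(\mu,\nu)$ be the set of couplings of $\mu$ and $\nu$, and put $$P=\inf_{\pi\in\Pi(\mu,\nu)}\int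 c\,\mathrm d\pi+\varepsilon\,\mathrm{KL}(\pi\mid\xi)\in[0,\infty],\qquad \mathrm{KL}(\pi\mid\xi)=\int\log\frac{\mathrm d\pi}{\mathrm d\xi}\,\mathrm d\pi,$$ with $\mathrm{KL}(\pi\mid\xi)=\infty$ if $\pi\not\ll\xi$. For $f\in L^1(\mu)$ and $g\in L^1(\nu)$ put $$D(f,g)=\int f\,\mathrm d\mu+\int g\,\mathrm d\nu-\varepsilon\int\exp\Big(\frac{f(x)+g(y)-c(x,y)}{\varepsilon}\Big)\mathrm d\xi(x,y)\in[-\infty,\infty),$$ and let $D^\star=\sup D(f,g)$ over all continuous $f\in L^1(\mu)$ and $g\in L^1(\nu)$ (that is, over all continuous $f,g$ if $X$ and $Y$ are compact). Then: 1. (Strong duality) $P=D^\star+\varepsilon$ (both may be $+\infty$), and $D^\star$ is also the supremum of $D$ over all $f\in L^1(\mu)$, $g\in L^1(\nu)$. 2. The infimum $P$ is attained; if $P<\infty$, there is exactly one optimal plan. 3. (Recovery) If $f^\star\in L^1(\mu)$ and $g^\star\in L^1(\nu)$ satisfy $D(f^\star,g^\star)=D^\star$ (in particular, if they are continuous maximizers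 of the dual problem), then the unique optimal plan $\pi^\star$ is given by $\mathrm d\pi^\star(x,y)=\exp\big(\frac{f^\star(x)+g^\star(y)-c(x,y)}{\varepsilon}\big)\mathrm d\xi(x,y)$. 4. (Attainment) If $\gamma>0$ and $\int c\,\mathrm d\xi<\infty$, then there are measurable $f^\star\in L^1(\mu)$, $g^\star\in L^1(\nu)$ with $D(f^\star,g^\star)=D^\star$. If $\mu$ and $\nu$ are finitely supported, then, for every $\gamma\in[0,1]$, there are continuous such $f^\star,g^\star$. -/

import Mathlib

open MeasureTheory ProbabilityTheory Set
open scoped ENNReal NNReal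

noncomputable section

namespace SROT

/-- The set `Π(μ, ν)` of transport plans: measures on `X × Y` with marginals `μ` and `ν`. -/
def plans {X Y : Type*} [MeasurableSpace X] [MeasurableSpace Y] (μ : Measure X) (ν : Measure Y) :
    Set (Measure (X × Y)) :=
  {π | π.map Prod.fst = μ ∧ π.map Prod.snd = ν}

/-- The quantile function `F_ρ⁻¹(u) = inf {t | u ≤ F_ρ(t)}` of a probability measure on `ℝ`.
(Only its values for `0 < u < 1` matter; there the set is nonempty and bounded below.) -/
def quantile (ρ : Measure ℝ) (u : ℝ) : ℝ := sInf {t : ℝ | u ≤ cdf ρ t}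

/-- The one-dimensional optimal (monotone) plan between two laws on `ℝ`: the image of the uniform
law on `[0, 1]` under the pair of quantile functions. -/
def oneDimPlan (ρ₁ ρ₂ : Measure ℝ) : Measure (ℝ × ℝ) :=
  (volume.restrict (Icc (0 : ℝ) 1)).map (fun u => (quantile ρ₁ u, quantile ρ₂ u))

/-- The lifted plan of one slice, for projections `P : X → ℝ` and `Q : Y → ℝ`: draw `(t₁, t₂)` from
the monotone plan between `P♯μ` and `Q♯ν`, and then draw independently `x` from `μ` conditioned on
`P x = t₁` and `y` from `ν` conditioned on `Q y = t₂`. -/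
def liftedPlan {X Y : Type*}
    [MeasurableSpace X] [StandardBorelSpace X] [Nonempty X]
    [MeasurableSpace Y] [StandardBorelSpace Y] [Nonempty Y]
    (μ : Measure X) [IsProbabilityMeasure μ] (ν : Measure Y) [IsProbabilityMeasure ν]
    (P : X → ℝ) (Q : Y → ℝ) : Measure (X × Y) :=
  (oneDimPlan (μ.map P) (ν.map Q)).bind
    (fun t => (condDistrib id P μ t.1).prod (condDistrib id Q ν t.2))

/-- The sliced optimal transport plan `π^SOT = E_{θ ∼ σ}[π_θ]`, where `π_θ` is the lifted plan of
the slice with projections `p θ : X → ℝ` and `q θ : Y → ℝ`. -/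
def sotPlan {X Y Θ : Type*} [MeasurableSpace Θ]
    [MeasurableSpace X] [StandardBorelSpace X] [Nonempty X]
    [MeasurableSpace Y] [StandardBorelSpace Y] [Nonempty Y]
    (μ : Measure X) [IsProbabilityMeasure μ] (ν : Measure Y) [IsProbabilityMeasure ν]
    (σ : Measure Θ) (p : Θ → X → ℝ) (q : Θ → Y → ℝ) : Measure (X × Y) :=
  σ.bind (fun θ => liftedPlan μ ν (p θ) (q θ))

/-- The smoothed sliced plan `(1 - γ) π^SOT + γ μ ⊗ ν`, for `γ ∈ [0, 1]`. -/
def smoothedSOTPlan {X Y Θ : Type*} [MeasurableSpace Θ]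
    [MeasurableSpace X] [StandardBorelSpace X] [Nonempty X]
    [MeasurableSpace Y] [StandardBorelSpace Y] [Nonempty Y]
    (μ : Measure X) [IsProbabilityMeasure μ] (ν : Measure Y) [IsProbabilityMeasure ν]
    (σ : Measure Θ) (p : Θ → X → ℝ) (q : Θ → Y → ℝ) (γ : ℝ) : Measure (X × Y) :=
  ENNReal.ofReal (1 - γ) • sotPlan μ ν σ p q + ENNReal.ofReal γ • μ.prod ν

section Problem

variable {X Y : Type*} [MeasurableSpace X] [MeasurableSpace Y]

/-- The primal objective `∫ c dπ + ε KL(π | ξ)`, with values in `[0, ∞]`. (Between probability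
measures `klDiv π ξ` is `∫ log (dπ/dξ) dπ` if `π ≪ ξ` and this integral is finite, else `∞`.) -/
def primalObjective (c : X × Y → ℝ≥0) (ξ : Measure (X × Y)) (ε : ℝ) (π : Measure (X × Y)) : ℝ≥0∞ :=
  ∫⁻ z, (c z : ℝ≥0∞) ∂π + ENNReal.ofReal ε * InformationTheory.klDiv π ξ

/-- The optimal value of the primal problem. -/
def primalValue (μ : Measure X) (ν : Measure Y) (c : X × Y → ℝ≥0) (ξ : Measure (X × Y)) (ε : ℝ) :
    ℝ≥0∞ :=
  ⨅ π ∈ plans μ ν, primalObjective c ξ ε π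

/-- `π` is an optimal plan: a minimizer of the primal objective over `Π(μ, ν)`. -/
def IsOptimalPlan (μ : Measure X) (ν : Measure Y) (c : X × Y → ℝ≥0) (ξ : Measure (X × Y)) (ε : ℝ)
    (π : Measure (X × Y)) : Prop :=
  π ∈ plans μ ν ∧ ∀ π' ∈ plans μ ν, primalObjective c ξ ε π ≤ primalObjective c ξ ε π'

/-- The dual objective `∫ f dμ + ∫ g dν - ε ∫ exp ((f + g - c) / ε) dR`, for `f` and `g`
integrable; its value is `-∞` where the exponential is not integrable. -/
def dualObjective (μ : Measure X) (ν : Measure Y) (c : X × Y → ℝ≥0) (ξ : Measure (X × Y)) (ε : ℝ)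
    (f : X → ℝ) (g : Y → ℝ) : EReal :=
  ((∫ x, f x ∂μ + ∫ y, g y ∂ν : ℝ) : EReal) -
    ((ENNReal.ofReal ε *
      ∫⁻ z, ENNReal.ofReal (Real.exp ((f z.1 + g z.2 - c z) / ε)) ∂ξ : ℝ≥0∞) : EReal)

/-- The value of the dual problem: the supremum of the dual objective over continuous potentials
(which are integrable, as always when `X` and `Y` are compact). -/
def dualValue [TopologicalSpace X] [TopologicalSpace Y]
    (μ : Measure X) (ν : Measure Y) (c : X × Y → ℝ≥0) (ξ : Measure (X × Y)) (ε : ℝ) : EReal :=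
  ⨆ (f : C(X, ℝ)) (g : C(Y, ℝ)) (_ : Integrable f μ) (_ : Integrable g ν),
    dualObjective μ ν c ξ ε f g

/-- `(f, g)` is a pair of optimal dual potentials: integrable potentials at which the dual objective
takes the value of the dual problem. If `f` and `g` are continuous, this says that `(f, g)` is a
maximizer of the dual problem. -/
def IsOptimalDualPair [TopologicalSpace X] [TopologicalSpace Y]
    (μ : Measure X) (ν : Measure Y) (c : X × Y → ℝ≥0) (ξ : Measure (X × Y)) (ε : ℝ)
    (f : X → ℝ) (g : Y → ℝ) : Prop :=
  Integrable f μ ∧ Integrable g ν ∧ dualObjective μ ν c ξ ε f g = dualValue μ ν c ξ ε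

/-- The measure `exp ((f + g - c) / ε) ξ` recovered from a pair of potentials. -/
def recoveredPlan (c : X × Y → ℝ≥0) (ξ : Measure (X × Y)) (ε : ℝ) (f : X → ℝ) (g : Y → ℝ) :
    Measure (X × Y) :=
  ξ.withDensity (fun z => ENNReal.ofReal (Real.exp ((f z.1 + g z.2 - c z) / ε)))

end Problem

end SROT

end

/-!
The reference plan `ξ` enters only through the fact that it is a coupling of `μ` and `ν`
(`smoothedSOTPlan_mem_plans`) and, with smoothing, through `γ • μ.prod ν ≤ ξ`. Its marginals
are computed from the quantile transform and the disintegration of `μ` and `ν`; the only delicate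
point is that the conditional laws are chosen for each slice separately, so measurability of
`π_θ` in `θ` needs a jointly measurable version (`measurable_liftedPlan`).

For a coupling `ξ`, set `τ = exp (-c / ε) ξ` (`costMeasure`). The dual objective at `ε f` and `ε g`
is `ε J h` with `h = f ⊕ g` and `J h = ∫ h dξ - ∫ exp h dτ`. The sums `f ⊕ g` form a linear space,
and comparing `J` at `h`, `k` and `(h + k) / 2` shows that `exp (h / 2)` and `exp (k / 2)` are close
in `L²(τ)` if `h` and `k` almost maximize `J` over bounded continuous `f` and `g`. Hence, if the
dual value is finite, `exp (h n)` converges in `L¹(τ)` along a fast maximizing sequence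
(`exists_maximizing_sequence`), without any compactness argument. The limit density `ρ` defines a
coupling, by the first-order condition for the competitors `h n + s k` (`integral_mul_limit_eq`),
and its entropy is at most the dual value, by Fatou's lemma and the competitors `(1 - r) h n`
(`lintegral_klFun_limit_le`). So the plan `ρ τ` closes the duality gap.

The converse inequality comes in a quantitative form (`dual_add_hellinger_le`): the gap between a
plan of density `ρ` and potentials `f`, `g` is at least
`ε ∫ (√ρ - exp ((f + g - c) / (2 ε)))² dξ`. This gives weak duality for all integrable potentials,
the recovery formula (a vanishing gap forces equality of the densities), and uniqueness of the
optimal plan (two optimal plans are both close to the plan of an almost optimal pair).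

If `c` is `ξ`-integrable, Fatou's lemma applied to `exp s - s`, with `s = h n - c / ε`, shows that
`h n` converges to a finite, integrable limit `ξ`-almost everywhere
(`exists_limit_of_potentials`). The remaining point is that the limit is again of the form
`F ⊕ G`: if `γ > 0`, the convergence holds almost everywhere for `μ ⊗ ν` and the variables
separate by Fubini's theorem (`exists_separate_limits`); if the marginals are finitely supported,
the sums `f ⊕ g` form a finite-dimensional, hence closed, space of functions on the support. In both
cases complementary slackness shows that the limit potentials are optimal.
-/

open Filter Topology InformationTheory
open scoped BoundedContinuousFunction

namespace SROT

/-! ### Quantile functions and the monotone plan on the line -/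

lemma quantile_le_iff (ρ : Measure ℝ) {u : ℝ} (hu : u ∈ Ioo (0 : ℝ) 1) (t : ℝ) :
    quantile ρ u ≤ t ↔ u ≤ cdf ρ t := by
  obtain ⟨b, hb⟩ := ((tendsto_cdf_atBot ρ).eventually (gt_mem_nhds hu.1)).exists
  obtain ⟨a, ha⟩ := ((tendsto_cdf_atTop ρ).eventually (lt_mem_nhds hu.2)).exists
  have hbdd : BddBelow {t : ℝ | u ≤ cdf ρ t} :=
    ⟨b, fun s hs => le_of_not_gt fun h => absurd (monotone_cdf ρ h.le) (not_le.2 (hb.trans_le hs))⟩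
  have hne : {t : ℝ | u ≤ cdf ρ t}.Nonempty := ⟨a, ha.le⟩
  refine ⟨fun h => ?_, fun h => csInf_le hbdd h⟩
  -- right continuity of the distribution function puts the infimum into the set
  have hright : Filter.Tendsto (cdf ρ) (nhdsWithin t (Ioi t)) (nhds (cdf ρ t)) :=
    ((cdf ρ).right_continuous t).mono_left (nhdsWithin_mono _ Ioi_subset_Ici_self)
  refine ge_of_tendsto hright ?_
  filter_upwards [self_mem_nhdsWithin] with s hs
  obtain ⟨r, hr, hrs⟩ := exists_lt_of_csInf_lt hne (lt_of_le_of_lt h hs)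
  exact le_trans hr (monotone_cdf ρ hrs.le)

lemma measurable_quantile_uncurry {Θ : Type*} [MeasurableSpace Θ] (ρ : Θ → Measure ℝ)
    [∀ θ, IsProbabilityMeasure (ρ θ)] (hρ : Measurable ρ) :
    Measurable (fun z : Θ × ℝ => (Ioo (0 : ℝ) 1).indicator (quantile (ρ z.1)) z.2) := by
  have hs : MeasurableSet {z : Θ × ℝ | z.2 ∈ Ioo (0 : ℝ) 1} := measurable_snd measurableSet_Ioo
  have hcdf : ∀ t, Measurable (fun θ => cdf (ρ θ) t) := fun t => by
    simp_rw [cdf_eq_real, Measure.real]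
    exact ((Measure.measurable_coe measurableSet_Iic).comp hρ).ennreal_toReal
  refine measurable_of_Iic fun t => ?_
  have : (fun z : Θ × ℝ => (Ioo (0 : ℝ) 1).indicator (quantile (ρ z.1)) z.2) ⁻¹' Iic t =
      ({z | z.2 ∈ Ioo (0 : ℝ) 1} ∩ {z | z.2 ≤ cdf (ρ z.1) t}) ∪
        ({z | z.2 ∈ Ioo (0 : ℝ) 1}ᶜ ∩ {_z | (0 : ℝ) ≤ t}) := by
    ext z
    by_cases hz : z.2 ∈ Ioo (0 : ℝ) 1
    · simp only [mem_preimage, mem_Iic, indicator_of_mem hz, quantile_le_iff _ hz]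
      simp [hz.1, hz.2]
    · simp only [mem_preimage, mem_Iic, indicator_of_notMem hz, mem_union, mem_inter_iff,
        mem_compl_iff, mem_ofPred_eq, hz]
      tauto
  rw [this]
  exact (hs.inter (measurableSet_le measurable_snd ((hcdf t).comp measurable_fst))).union
    (hs.compl.inter (MeasurableSet.const _))

lemma quantile_ae_eq_indicator (ρ : Measure ℝ) :
    quantile ρ =ᵐ[volume.restrict (Icc (0 : ℝ) 1)] (Ioo (0 : ℝ) 1).indicator (quantile ρ) := by
  rw [← restrict_Ioo_eq_restrict_Icc]
  filter_upwards [ae_restrict_mem measurableSet_Ioo] with u hu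
  rw [indicator_of_mem hu]

lemma measurable_indicator_quantile (ρ : Measure ℝ) [IsProbabilityMeasure ρ] :
    Measurable ((Ioo (0 : ℝ) 1).indicator (quantile ρ)) :=
  (measurable_quantile_uncurry (fun _ : Unit => ρ) measurable_const).comp
    (measurable_prodMk_left (x := ()))

lemma aemeasurable_quantile (ρ : Measure ℝ) [IsProbabilityMeasure ρ] :
    AEMeasurable (quantile ρ) (volume.restrict (Icc (0 : ℝ) 1)) :=
  ⟨_, measurable_indicator_quantile ρ, quantile_ae_eq_indicator ρ⟩

lemma map_quantile (ρ : Measure ℝ) [IsProbabilityMeasure ρ] :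
    (volume.restrict (Icc (0 : ℝ) 1)).map (quantile ρ) = ρ := by
  refine (Measure.ext_of_Iic _ _ fun t => ?_).symm
  rw [Measure.map_congr (quantile_ae_eq_indicator ρ),
    Measure.map_apply (measurable_indicator_quantile ρ) measurableSet_Iic,
    ← restrict_Ioo_eq_restrict_Icc,
    Measure.restrict_apply (measurable_indicator_quantile ρ measurableSet_Iic)]
  have h0 : 0 ≤ cdf ρ t := cdf_nonneg ρ t
  have h1 : cdf ρ t ≤ 1 := cdf_le_one ρ t
  have hset : (Ioo (0 : ℝ) 1).indicator (quantile ρ) ⁻¹' Iic t ∩ Ioo 0 1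
      = Ioo 0 1 ∩ Iic (cdf ρ t) := by
    ext u
    by_cases hu : u ∈ Ioo (0 : ℝ) 1
    · simp only [mem_inter_iff, mem_preimage, mem_Iic, indicator_of_mem hu, quantile_le_iff _ hu]
      tauto
    · simp [hu]
  have hvol : volume (Ioo (0 : ℝ) 1 ∩ Iic (cdf ρ t)) = ENNReal.ofReal (cdf ρ t) := by
    apply le_antisymm
    · refine (measure_mono (t := Icc 0 (cdf ρ t)) fun u hu => ⟨hu.1.1.le, hu.2⟩).trans ?_
      simp
    · refine le_trans ?_ (measure_mono (s := Ioo 0 (cdf ρ t))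
        fun u hu => ⟨⟨hu.1, hu.2.trans_le h1⟩, hu.2.le⟩)
      simp
  rw [hset, hvol, cdf_eq_real, Measure.real, ENNReal.ofReal_toReal (measure_ne_top _ _)]

lemma oneDimPlan_mem_plans (ρ₁ ρ₂ : Measure ℝ) [IsProbabilityMeasure ρ₁] [IsProbabilityMeasure ρ₂] :
    oneDimPlan ρ₁ ρ₂ ∈ plans ρ₁ ρ₂ := by
  have h := (aemeasurable_quantile ρ₁).prodMk (aemeasurable_quantile ρ₂)
  constructor
  · rw [oneDimPlan, AEMeasurable.map_map_of_aemeasurable measurable_fst.aemeasurable h]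
    exact map_quantile ρ₁
  · rw [oneDimPlan, AEMeasurable.map_map_of_aemeasurable measurable_snd.aemeasurable h]
    exact map_quantile ρ₂

/-! ### Marginals and measurability of the lifted plans -/

section Plans

variable {X Y Θ : Type*} [MeasurableSpace X] [MeasurableSpace Y] [MeasurableSpace Θ]

lemma isProbabilityMeasure_of_mem_plans {μ : Measure X} [IsProbabilityMeasure μ] {ν : Measure Y}
    {π : Measure (X × Y)} (h : π ∈ plans μ ν) : IsProbabilityMeasure π := by
  have : IsProbabilityMeasure (π.map Prod.fst) := by rw [h.1]; infer_instance
  exact Measure.isProbabilityMeasure_of_map Prod.fst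

/-- Mixtures of couplings are couplings. -/
lemma bind_mem_plans {σ : Measure Θ} [IsProbabilityMeasure σ] {μ : Measure X} {ν : Measure Y}
    {κ : Θ → Measure (X × Y)} (hκ : Measurable κ) (h : ∀ θ, κ θ ∈ plans μ ν) :
    σ.bind κ ∈ plans μ ν := by
  constructor
  · have := Measure.map_comp σ ⟨κ, hκ⟩ measurable_fst
    rw [Kernel.coe_mk] at this
    rw [this]
    have h' : ⇑((⟨κ, hκ⟩ : Kernel Θ (X × Y)).map Prod.fst) = fun _ => μ := by
      ext1 θ
      rw [Kernel.map_apply _ measurable_fst]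
      exact (h θ).1
    rw [h', Measure.bind_const]
    simp
  · have := Measure.map_comp σ ⟨κ, hκ⟩ measurable_snd
    rw [Kernel.coe_mk] at this
    rw [this]
    have h' : ⇑((⟨κ, hκ⟩ : Kernel Θ (X × Y)).map Prod.snd) = fun _ => ν := by
      ext1 θ
      rw [Kernel.map_apply _ measurable_snd]
      exact (h θ).2
    rw [h', Measure.bind_const]
    simp

/-- Gluing two disintegrations along a coupling of the laws of their parameters. -/
lemma bind_prod_mem_plans {A B : Type*} [MeasurableSpace A] [MeasurableSpace B]
    (κ : Kernel A X) [IsMarkovKernel κ] (η : Kernel B Y) [IsMarkovKernel η]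
    {ρ₁ : Measure A} {ρ₂ : Measure B} {τ : Measure (A × B)} (hτ : τ ∈ plans ρ₁ ρ₂) :
    τ.bind (fun t => (κ t.1).prod (η t.2)) ∈ plans (ρ₁.bind κ) (ρ₂.bind η) := by
  have hk : (fun t : A × B => (κ t.1).prod (η t.2)) =
      ⇑((κ.comap Prod.fst measurable_fst) ×ₖ (η.comap Prod.snd measurable_snd)) := by
    ext1 t
    rw [Kernel.prod_apply, Kernel.comap_apply, Kernel.comap_apply]
  rw [hk]
  constructor
  · rw [Measure.map_comp _ _ measurable_fst, ← Kernel.fst_eq, Kernel.fst_prod, ← hτ.1,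
      ← Measure.deterministic_comp_eq_map measurable_fst, Measure.comp_assoc,
      Kernel.comp_deterministic_eq_comap]
  · rw [Measure.map_comp _ _ measurable_snd, ← Kernel.snd_eq, Kernel.snd_prod, ← hτ.2,
      ← Measure.deterministic_comp_eq_map measurable_snd, Measure.comp_assoc,
      Kernel.comp_deterministic_eq_comap]

lemma prod_mem_plans (μ : Measure X) [IsProbabilityMeasure μ] (ν : Measure Y)
    [IsProbabilityMeasure ν] : μ.prod ν ∈ plans μ ν :=
  ⟨by rw [Measure.map_fst_prod]; simp, by rw [Measure.map_snd_prod]; simp⟩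

lemma measurable_map_uncurry (μ : Measure X) [IsProbabilityMeasure μ] (p : Θ → X → ℝ)
     (hp : Measurable (fun z : Θ × X => p z.1 z.2)) :
    Measurable (fun θ => μ.map (p θ)) := by
  refine Measure.measurable_of_measurable_coe _ fun s hs => ?_
  have : ∀ θ, μ.map (p θ) s = μ (Prod.mk θ ⁻¹' ((fun z : Θ × X => p z.1 z.2) ⁻¹' s)) := fun θ =>
    Measure.map_apply (hp.comp measurable_prodMk_left) hs
  simp_rw [this]
  exact measurable_measure_prodMk_left (hp hs)

variable [StandardBorelSpace X] [Nonempty X] [StandardBorelSpace Y] [Nonempty Y]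
  (μ : Measure X) [IsProbabilityMeasure μ] (ν : Measure Y) [IsProbabilityMeasure ν]

lemma liftedPlan_mem_plans {P : X → ℝ} {Q : Y → ℝ} (hP : Measurable P) (hQ : Measurable Q) :
    liftedPlan μ ν P Q ∈ plans μ ν := by
  have := Measure.isProbabilityMeasure_map (μ := μ) hP.aemeasurable
  have := Measure.isProbabilityMeasure_map (μ := ν) hQ.aemeasurable
  have h := bind_prod_mem_plans (condDistrib id P μ) (condDistrib id Q ν)
    (oneDimPlan_mem_plans (μ.map P) (ν.map Q))
  rwa [condDistrib_comp_map hP.aemeasurable aemeasurable_id,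
    condDistrib_comp_map hQ.aemeasurable aemeasurable_id, Measure.map_id, Measure.map_id] at h

/-- A version of the conditional laws of all slices that is jointly measurable in `θ` and `t`. -/
lemma exists_kernel_condDistrib (p : Θ → X → ℝ) (hp : Measurable (fun z : Θ × X => p z.1 z.2)) :
    ∃ κ : Kernel (Θ × ℝ) X, IsMarkovKernel κ ∧
      ∀ θ, (fun t => κ (θ, t)) =ᵐ[μ.map (p θ)] condDistrib id (p θ) μ := by
  have hpθ : ∀ θ, Measurable (p θ) := fun θ => hp.comp measurable_prodMk_left
  let K : Kernel Θ (ℝ × X) := (Kernel.deterministic id measurable_id ×ₖ Kernel.const Θ μ).map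
    (fun z => (p z.1 z.2, z.2))
  have hmeas : Measurable (fun z : Θ × X => (p z.1 z.2, z.2)) := hp.prodMk measurable_snd
  have hK : ∀ θ, K θ = μ.map (fun x => (p θ x, x)) := fun θ => by
    rw [Kernel.map_apply _ hmeas, Kernel.prod_apply, Kernel.deterministic_apply,
      Kernel.const_apply, Measure.dirac_prod, Measure.map_map hmeas measurable_prodMk_left]
    rfl
  have : IsMarkovKernel K := Kernel.IsMarkovKernel.map _ hmeas
  refine ⟨K.condKernel, inferInstance, fun θ => ?_⟩
  have h := Kernel.condKernel_apply_eq_condKernel K θ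
  have hfst : Kernel.fst K θ = μ.map (p θ) := by
    rw [Kernel.fst_apply, hK, Measure.map_map measurable_fst ((hpθ θ).prodMk measurable_id')]
    rfl
  rw [hfst] at h
  filter_upwards [h] with t ht
  rw [ht, condDistrib]
  simp only [id, hK θ]

lemma liftedPlan_eq_bind {P : X → ℝ} {Q : Y → ℝ} (hP : Measurable P) (hQ : Measurable Q)
    (κ : Kernel ℝ X) [IsMarkovKernel κ] (η : Kernel ℝ Y) [IsMarkovKernel η]
    (hκ : κ =ᵐ[μ.map P] condDistrib id P μ) (hη : η =ᵐ[ν.map Q] condDistrib id Q ν) :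
    liftedPlan μ ν P Q = (volume.restrict (Icc (0 : ℝ) 1)).bind
      (fun u => (κ ((Ioo (0 : ℝ) 1).indicator (quantile (μ.map P)) u)).prod
        (η ((Ioo (0 : ℝ) 1).indicator (quantile (ν.map Q)) u))) := by
  have := Measure.isProbabilityMeasure_map (μ := μ) hP.aemeasurable
  have := Measure.isProbabilityMeasure_map (μ := ν) hQ.aemeasurable
  have hplan := oneDimPlan_mem_plans (μ.map P) (ν.map Q)
  rw [← hplan.1] at hκ
  rw [← hplan.2] at hη
  have hcong : (fun t : ℝ × ℝ => (condDistrib id P μ t.1).prod (condDistrib id Q ν t.2))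
      =ᵐ[oneDimPlan (μ.map P) (ν.map Q)]
      ⇑((κ.comap Prod.fst measurable_fst) ×ₖ (η.comap Prod.snd measurable_snd)) := by
    filter_upwards [ae_of_ae_map measurable_fst.aemeasurable hκ,
      ae_of_ae_map measurable_snd.aemeasurable hη] with t ht1 ht2
    rw [Kernel.prod_apply, Kernel.comap_apply, Kernel.comap_apply, ht1, ht2]
  have hpair : (fun u => (quantile (μ.map P) u, quantile (ν.map Q) u))
      =ᵐ[volume.restrict (Icc (0 : ℝ) 1)]
      fun u => ((Ioo (0 : ℝ) 1).indicator (quantile (μ.map P)) u,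
        (Ioo (0 : ℝ) 1).indicator (quantile (ν.map Q)) u) := by
    filter_upwards [quantile_ae_eq_indicator (μ.map P),
      quantile_ae_eq_indicator (ν.map Q)] with u h1 h2
    rw [h1, h2]
  rw [liftedPlan, Measure.bind_congr_right hcong, oneDimPlan, Measure.map_congr hpair,
    ← Measure.deterministic_comp_eq_map ((measurable_indicator_quantile _).prodMk
      (measurable_indicator_quantile _)), Measure.comp_assoc,
    Kernel.comp_deterministic_eq_comap]
  congr 1
  ext1 u
  rw [Kernel.comap_apply, Kernel.prod_apply, Kernel.comap_apply, Kernel.comap_apply]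

/-- The conditional laws in the slice `θ` are only determined up to null sets, and they are chosen
for each `θ` separately. The plan does not depend on the choice, so it can be computed
with versions that are jointly measurable in `θ` and the value of the projection. -/
lemma measurable_liftedPlan (p : Θ → X → ℝ) (hp : Measurable (fun z : Θ × X => p z.1 z.2))
    (q : Θ → Y → ℝ) (hq : Measurable (fun z : Θ × Y => q z.1 z.2)) :
    Measurable (fun θ => liftedPlan μ ν (p θ) (q θ)) := by
  have hpθ : ∀ θ, Measurable (p θ) := fun θ => hp.comp measurable_prodMk_left
  have hqθ : ∀ θ, Measurable (q θ) := fun θ => hq.comp measurable_prodMk_left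
  obtain ⟨κ, _, hκ⟩ := exists_kernel_condDistrib μ p hp
  obtain ⟨η, _, hη⟩ := exists_kernel_condDistrib ν q hq
  have := fun θ => Measure.isProbabilityMeasure_map (μ := μ) (hpθ θ).aemeasurable
  have := fun θ => Measure.isProbabilityMeasure_map (μ := ν) (hqθ θ).aemeasurable
  have hQp := measurable_quantile_uncurry _ (measurable_map_uncurry μ p hp)
  have hQq := measurable_quantile_uncurry _ (measurable_map_uncurry ν q hq)
  let K : Kernel (Θ × ℝ) (X × Y) :=
    (κ.comap _ (measurable_fst.prodMk hQp)) ×ₖ (η.comap _ (measurable_fst.prodMk hQq))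
  have key : ∀ θ, liftedPlan μ ν (p θ) (q θ) =
      (volume.restrict (Icc (0 : ℝ) 1)).bind (fun u => K (θ, u)) := fun θ => by
    rw [liftedPlan_eq_bind μ ν (hpθ θ) (hqθ θ)
      (κ.comap (Prod.mk θ) measurable_prodMk_left) (η.comap (Prod.mk θ) measurable_prodMk_left)
      (hκ θ) (hη θ)]
    congr 1
    ext1 u
    rw [Kernel.prod_apply, Kernel.comap_apply, Kernel.comap_apply, Kernel.comap_apply,
      Kernel.comap_apply]
  simp_rw [key]
  refine Measure.measurable_of_measurable_coe _ fun s hs => ?_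
  have : ∀ θ, (volume.restrict (Icc (0 : ℝ) 1)).bind (fun u => K (θ, u)) s =
      ∫⁻ u in Icc (0 : ℝ) 1, K (θ, u) s := fun θ =>
    Measure.bind_apply hs (K.measurable.comp measurable_prodMk_left).aemeasurable
  simp_rw [this]
  exact (K.measurable_coe hs).lintegral_prod_right'

lemma smoothedSOTPlan_mem_plans {σ : Measure Θ} [IsProbabilityMeasure σ]
    {p : Θ → X → ℝ} (hp : Measurable (fun z : Θ × X => p z.1 z.2))
    {q : Θ → Y → ℝ} (hq : Measurable (fun z : Θ × Y => q z.1 z.2))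
    {γ : ℝ} (hγ : γ ∈ Icc (0 : ℝ) 1) : smoothedSOTPlan μ ν σ p q γ ∈ plans μ ν := by
  have h1 : sotPlan μ ν σ p q ∈ plans μ ν := bind_mem_plans (measurable_liftedPlan μ ν p hp q hq)
    fun θ => liftedPlan_mem_plans μ ν (hp.comp measurable_prodMk_left)
      (hq.comp measurable_prodMk_left)
  have h2 := prod_mem_plans μ ν
  have hsum : ENNReal.ofReal (1 - γ) + ENNReal.ofReal γ = 1 := by
    rw [← ENNReal.ofReal_add (by linarith [hγ.2]) hγ.1]; simp
  constructor
  · rw [smoothedSOTPlan, Measure.map_add _ _ measurable_fst, Measure.map_smul, Measure.map_smul,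
      h1.1, h2.1, ← add_smul, hsum, one_smul]
  · rw [smoothedSOTPlan, Measure.map_add _ _ measurable_snd, Measure.map_smul, Measure.map_smul,
      h1.2, h2.2, ← add_smul, hsum, one_smul]

end Plans

/-! ### Maximizing sequences of the entropic dual functional -/

section AbstractDual

variable {Z : Type*} [MeasurableSpace Z]

/-- The entropic dual functional `J h = ∫ h dξ - ∫ exp h dτ` for `ε = 1`, where the cost is absorbed
into the reference measure `τ = exp (-c) ξ`. -/
noncomputable def logDual (ξ τ : Measure Z) (h : Z → ℝ) : ℝ := ∫ z, h z ∂ξ - ∫ z, Real.exp (h z) ∂τ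

/-- A linear space of bounded measurable test functions. -/
structure IsTestSpace (V : Submodule ℝ (Z → ℝ)) : Prop where
  measurable : ∀ h ∈ V, Measurable h
  bounded : ∀ h ∈ V, ∃ C, ∀ z, |h z| ≤ C

/-- Fatou's lemma for the integrals of positive parts along an almost everywhere convergent
sequence. -/
lemma lintegral_ofReal_le_of_tendsto {τ : Measure Z} {f : ℕ → Z → ℝ} {g : Z → ℝ} {a : ℕ → ℝ} {b : ℝ}
    (hf : ∀ n, AEMeasurable (f n) τ)
    (hlim : ∀ᵐ z ∂τ, Tendsto (fun n => f n z) atTop (𝓝 (g z)))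
    (hle : ∀ n, ∫⁻ z, ENNReal.ofReal (f n z) ∂τ ≤ ENNReal.ofReal (a n))
    (ha : Tendsto a atTop (𝓝 b)) :
    ∫⁻ z, ENNReal.ofReal (g z) ∂τ ≤ ENNReal.ofReal b := by
  calc ∫⁻ z, ENNReal.ofReal (g z) ∂τ
      = ∫⁻ z, liminf (fun n => ENNReal.ofReal (f n z)) atTop ∂τ := by
        refine lintegral_congr_ae ?_
        filter_upwards [hlim] with z hz
        exact (ENNReal.tendsto_ofReal hz).liminf_eq.symm
    _ ≤ liminf (fun n => ∫⁻ z, ENNReal.ofReal (f n z) ∂τ) atTop :=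
        lintegral_liminf_le' fun n => (hf n).ennreal_ofReal
    _ ≤ liminf (fun n => ENNReal.ofReal (a n)) atTop :=
        liminf_le_liminf (Eventually.of_forall hle)
    _ = ENNReal.ofReal b := (ENNReal.tendsto_ofReal ha).liminf_eq

variable {ξ τ : Measure Z} [IsFiniteMeasure τ] {V : Submodule ℝ (Z → ℝ)}

lemma IsTestSpace.integrable [IsFiniteMeasure ξ] (hV : IsTestSpace V) {h : Z → ℝ} (hh : h ∈ V) :
    Integrable h ξ := by
  obtain ⟨C, hC⟩ := hV.bounded h hh
  exact Integrable.of_bound (hV.measurable h hh).aestronglyMeasurable C (ae_of_all _ hC)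

lemma IsTestSpace.memLp_exp (hV : IsTestSpace V) {h : Z → ℝ} (hh : h ∈ V) (p : ℝ≥0∞) :
    MemLp (fun z => Real.exp (h z)) p τ := by
  obtain ⟨C, hC⟩ := hV.bounded h hh
  refine MemLp.of_bound (hV.measurable h hh).exp.aestronglyMeasurable (Real.exp C)
    (ae_of_all _ fun z => ?_)
  rw [Real.norm_of_nonneg (Real.exp_pos _).le]
  exact Real.exp_le_exp.2 (le_of_abs_le (hC z))

lemma IsTestSpace.integrable_exp (hV : IsTestSpace V) {h : Z → ℝ} (hh : h ∈ V) :
    Integrable (fun z => Real.exp (h z)) τ :=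
  memLp_one_iff_integrable.1 (hV.memLp_exp hh 1)

/-- Strong concavity of the dual functional: near-maximizers `h`, `k` have `exp (h / 2)` and
`exp (k / 2)` close in `L²(τ)`. -/
lemma integral_sq_exp_half_sub_le [IsFiniteMeasure ξ] (hV : IsTestSpace V) {M : ℝ}
    (hM : ∀ h ∈ V, logDual ξ τ h ≤ M) {h k : Z → ℝ} (hh : h ∈ V) (hk : k ∈ V) :
    ∫ z, (Real.exp (h z / 2) - Real.exp (k z / 2)) ^ 2 ∂τ
      ≤ 2 * M - logDual ξ τ h - logDual ξ τ k := by
  have hmid : (1 / 2 : ℝ) • (h + k) ∈ V := V.smul_mem _ (V.add_mem hh hk)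
  have e : ∀ z, (Real.exp (h z / 2) - Real.exp (k z / 2)) ^ 2 =
      Real.exp (h z) + Real.exp (k z) - 2 * Real.exp (((1 / 2 : ℝ) • (h + k)) z) := fun z => by
    have e1 : Real.exp (h z) = Real.exp (h z / 2) ^ 2 := by rw [← Real.exp_nat_mul]; ring_nf
    have e2 : Real.exp (k z) = Real.exp (k z / 2) ^ 2 := by rw [← Real.exp_nat_mul]; ring_nf
    have e3 : Real.exp (((1 / 2 : ℝ) • (h + k)) z) = Real.exp (h z / 2) * Real.exp (k z / 2) := by
      rw [← Real.exp_add]; simp only [Pi.smul_apply, Pi.add_apply, smul_eq_mul]; ring_nf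
    rw [e1, e2, e3]; ring
  have hlin : ∫ z, ((1 / 2 : ℝ) • (h + k)) z ∂ξ = (∫ z, h z ∂ξ + ∫ z, k z ∂ξ) / 2 := by
    simp only [Pi.smul_apply, Pi.add_apply, smul_eq_mul]
    rw [integral_const_mul, integral_add (hV.integrable hh) (hV.integrable hk)]
    ring
  have := hM _ hmid
  simp_rw [e]
  have hadd : Integrable (fun z => Real.exp (h z) + Real.exp (k z)) τ :=
    (hV.integrable_exp hh).add (hV.integrable_exp hk)
  rw [integral_sub hadd ((hV.integrable_exp hmid).const_mul 2), integral_add (hV.integrable_exp hh)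
    (hV.integrable_exp hk), integral_const_mul]
  simp only [logDual] at this ⊢
  linarith

lemma eq_zero_of_forall_mul_le_sq {a B r : ℝ} (hr : 0 < r)
    (h : ∀ s, |s| ≤ r → s * a ≤ s ^ 2 * B) : a = 0 := by
  by_contra ha
  have hB : 0 ≤ B := by
    have h1 := h r (abs_of_pos hr).le
    have h2 := h (-r) (by rw [abs_neg, abs_of_pos hr])
    nlinarith [sq_nonneg r, pow_pos hr 2]
  -- a step `s` of the sign of `a`, so short that the quadratic term is at most half the linear one
  have ha' : 0 < |a| := abs_pos.2 ha
  set t := min r (|a| / (2 * (B + 1))) with ht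
  have htpos : 0 < t := lt_min hr (by positivity)
  have htB : t * (2 * (B + 1)) ≤ |a| := by
    calc t * (2 * (B + 1)) ≤ |a| / (2 * (B + 1)) * (2 * (B + 1)) := by
          gcongr; exact min_le_right _ _
      _ = |a| := by field_simp
  have key : t * |a| ≤ t ^ 2 * B := by
    rcases le_total 0 a with h0 | h0
    · rw [abs_of_nonneg h0]
      exact h t (by rw [abs_of_pos htpos]; exact min_le_left _ _)
    · rw [abs_of_nonpos h0]
      have := h (-t) (by rw [abs_neg, abs_of_pos htpos]; exact min_le_left _ _)
      nlinarith
  nlinarith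

/-- The convergence statements behind the existence of an optimal plan: along a fast maximizing
sequence, `exp h` converges almost everywhere and strongly in `L¹(τ)`. -/
lemma exists_maximizing_sequence [IsFiniteMeasure ξ] (hV : IsTestSpace V) {M : ℝ}
    (hM : IsLUB (logDual ξ τ '' V) M) :
    ∃ (h : ℕ → Z → ℝ) (ρ : Z → ℝ), (∀ n, h n ∈ V) ∧
      (∀ n, M - (1 / 4) ^ (n + 1) < logDual ξ τ (h n)) ∧
      Measurable ρ ∧ (∀ z, 0 ≤ ρ z) ∧ Integrable ρ τ ∧
      (∀ᵐ z ∂τ, Tendsto (fun n => Real.exp (h n z)) atTop (𝓝 (ρ z))) ∧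
      Tendsto (fun n => eLpNorm ((fun z => Real.exp (h n z)) - ρ) 1 τ) atTop (𝓝 0) := by
  have hM' : ∀ h ∈ V, logDual ξ τ h ≤ M := fun h hh => hM.1 ⟨h, hh, rfl⟩
  have hex : ∀ n : ℕ, ∃ h ∈ V, M - (1 / 4) ^ (n + 1) < logDual ξ τ h := fun n => by
    obtain ⟨_, ⟨h, hh, rfl⟩, h1, -⟩ := hM.exists_between
      (sub_lt_self M (by positivity : (0 : ℝ) < (1 / 4) ^ (n + 1)))
    exact ⟨h, hh, h1⟩
  choose h hhV hh using hex
  -- the errors `4⁻⁽ⁿ⁺¹⁾` make the `L²` distances smaller than `2⁻ⁿ`, which is summable, so the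
  -- whole sequence converges almost everywhere
  let u : ℕ → Z → ℝ := fun n z => Real.exp (h n z / 2)
  have hu : ∀ n, MemLp (u n) 2 τ := fun n => by
    have := hV.memLp_exp (τ := τ) (V.smul_mem (1 / 2 : ℝ) (hhV n)) 2
    convert this using 3 with z
    simp only [Pi.smul_apply, smul_eq_mul]; ring
  have hcau : ∀ N n m : ℕ, N ≤ n → N ≤ m → eLpNorm (u n - u m) 2 τ < (1 / 2) ^ N := by
    intro N n m hn hm
    have h1 := integral_sq_exp_half_sub_le hV hM' (hhV n) (hhV m)
    have hp : ∀ k, N ≤ k → ((1 : ℝ) / 4) ^ (k + 1) ≤ (1 / 4) ^ (N + 1) := fun k hk =>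
      pow_le_pow_of_le_one (by norm_num) (by norm_num) (by lia)
    have h2 : ∫ z, ‖(u n - u m) z‖ ^ (2 : ℝ≥0∞).toReal ∂τ < ((1 / 2) ^ N) ^ 2 := by
      have e : ∀ z, ‖(u n - u m) z‖ ^ (2 : ℝ≥0∞).toReal =
          (Real.exp (h n z / 2) - Real.exp (h m z / 2)) ^ 2 := fun z => by
        simp [u]
      simp_rw [e]
      have h3 : (((1 : ℝ) / 2) ^ N) ^ 2 = (1 / 4) ^ N := by
        rw [← pow_mul, mul_comm, pow_mul]; norm_num
      have h4 : ((1 : ℝ) / 4) ^ (N + 1) = (1 / 4) ^ N / 4 := by ring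
      have h5 : (0 : ℝ) < (1 / 4) ^ N := by positivity
      rw [h3]
      linarith [hp n hn, hp m hm, hh n, hh m]
    rw [((hu n).sub (hu m)).eLpNorm_eq_integral_rpow_norm (by norm_num) (by norm_num)]
    have h6 : ((1 : ℝ≥0∞) / 2) ^ N = ENNReal.ofReal ((1 / 2) ^ N) := by
      rw [ENNReal.ofReal_pow (by norm_num), ENNReal.ofReal_div_of_pos (by norm_num)]; simp
    rw [h6, ENNReal.ofReal_lt_ofReal_iff (by positivity)]
    have h7 : ((2 : ℝ≥0∞).toReal)⁻¹ = (1 / 2 : ℝ) := by norm_num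
    rw [h7, ← Real.sqrt_eq_rpow, Real.sqrt_lt' (by positivity)]
    exact h2
  have hB : ∑' i : ℕ, ((1 : ℝ≥0∞) / 2) ^ i ≠ ∞ := by
    rw [ENNReal.tsum_geometric, one_div, ENNReal.one_sub_inv_two, inv_inv]; norm_num
  have hsm : ∀ n, AEStronglyMeasurable (u n) τ := fun n => (hu n).1
  obtain ⟨v, hvm, hv⟩ := exists_stronglyMeasurable_limit_of_tendsto_ae hsm
    (Lp.ae_tendsto_of_cauchy_eLpNorm hsm (by norm_num) hB hcau)
  have hconv := Lp.cauchy_tendsto_of_tendsto hsm v hB hcau hv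
  have hvL : MemLp v 2 τ := Lp.memLp_of_cauchy_tendsto (by norm_num) hu v hvm.aestronglyMeasurable
    hconv
  refine ⟨h, fun z => v z ^ 2, hhV, hh, hvm.measurable.pow_const 2, fun z => sq_nonneg _,
    hvL.integrable_sq, ?_, ?_⟩
  · filter_upwards [hv] with z hz
    have e : ∀ n, Real.exp (h n z) = u n z ^ 2 := fun n => by
      simp only [u]; rw [← Real.exp_nat_mul]; ring_nf
    simp_rw [e]
    exact hz.pow 2
  · have hfac : ∀ n, ((fun z => Real.exp (h n z)) - fun z => v z ^ 2) = (u n - v) • (u n + v) :=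
      fun n => by
        ext z
        have e : Real.exp (h n z) = u n z ^ 2 := by
          simp only [u]; rw [← Real.exp_nat_mul]; ring_nf
        simp only [Pi.sub_apply, Pi.smul_apply', Pi.add_apply, smul_eq_mul, e]
        ring
    have hle : ∀ n, eLpNorm ((fun z => Real.exp (h n z)) - fun z => v z ^ 2) 1 τ ≤
        eLpNorm (u n - v) 2 τ * (eLpNorm (u n - v) 2 τ + eLpNorm ((2 : ℝ) • v) 2 τ) := fun n => by
      rw [hfac n]
      refine (eLpNorm_smul_le_mul_eLpNorm (p := 2) (q := 2) ((hsm n).add hvL.1)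
        ((hsm n).sub hvL.1)).trans ?_
      gcongr
      have : u n + v = (u n - v) + (2 : ℝ) • v := by
        ext z; simp only [Pi.add_apply, Pi.sub_apply, Pi.smul_apply, smul_eq_mul]; ring
      rw [this]
      exact eLpNorm_add_le ((hsm n).sub hvL.1) (hvL.1.const_smul 2) (by norm_num)
    have hlim : Tendsto (fun n => eLpNorm (u n - v) 2 τ *
        (eLpNorm (u n - v) 2 τ + eLpNorm ((2 : ℝ) • v) 2 τ)) atTop (𝓝 0) := by
      have hne : eLpNorm ((2 : ℝ) • v) 2 τ ≠ ∞ := (hvL.const_smul 2).2.ne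
      have := ENNReal.Tendsto.mul hconv (Or.inr (by simpa using hne))
        (hconv.add (tendsto_const_nhds (x := eLpNorm ((2 : ℝ) • v) 2 τ))) (Or.inr (by simp))
      simpa using this
    exact tendsto_of_tendsto_of_tendsto_of_le_of_le tendsto_const_nhds hlim
      (fun _ => zero_le) hle

/-- First-order condition for the limit density: it has the moments of `ξ` on the test space. -/
lemma integral_mul_limit_eq [IsFiniteMeasure ξ] (hV : IsTestSpace V) {M : ℝ}
    (hM : ∀ h ∈ V, logDual ξ τ h ≤ M)
    {h : ℕ → Z → ℝ} {ρ : Z → ℝ} {δ : ℕ → ℝ} (hδ : Tendsto δ atTop (𝓝 0))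
    (hhV : ∀ n, h n ∈ V) (hh : ∀ n, M - δ n ≤ logDual ξ τ (h n)) (hρ : Integrable ρ τ)
    (hρ0 : ∀ z, 0 ≤ ρ z)
    (hL : Tendsto (fun n => eLpNorm ((fun z => Real.exp (h n z)) - ρ) 1 τ) atTop (𝓝 0))
    {k : Z → ℝ} (hk : k ∈ V) : ∫ z, k z * ρ z ∂τ = ∫ z, k z ∂ξ := by
  have hkm := hV.measurable k hk
  obtain ⟨C, hC⟩ := hV.bounded k hk
  have hbddint : ∀ {f ψ : Z → ℝ}, Integrable f τ → Measurable ψ → (∃ B, ∀ z, |ψ z| ≤ B) →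
      Integrable (fun z => ψ z * f z) τ := fun hf hψ ⟨B, hB⟩ =>
    hf.bdd_mul hψ.aestronglyMeasurable (ae_of_all _ hB)
  have hlim : ∀ ψ : Z → ℝ, Measurable ψ → (∃ B, ∀ z, |ψ z| ≤ B) →
      Tendsto (fun n => ∫ z, ψ z * Real.exp (h n z) ∂τ) atTop (𝓝 (∫ z, ψ z * ρ z ∂τ)) := by
    rintro ψ hψ ⟨B, hB⟩
    refine tendsto_integral_of_L1' _ (hbddint hρ hψ ⟨B, hB⟩).1
      (F := fun n z => ψ z * Real.exp (h n z))
      (Eventually.of_forall fun n => hbddint (hV.integrable_exp (hhV n)) hψ ⟨B, hB⟩) ?_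
    have hle : ∀ n, eLpNorm ((fun z => ψ z * Real.exp (h n z)) - fun z => ψ z * ρ z) 1 τ ≤
        ENNReal.ofReal B * eLpNorm ((fun z => Real.exp (h n z)) - ρ) 1 τ := fun n => by
      refine eLpNorm_le_mul_eLpNorm_of_ae_le_mul (ae_of_all _ fun z => ?_) 1
      rw [Pi.sub_apply, Pi.sub_apply, ← mul_sub, norm_mul]
      gcongr
      exact hB z
    refine tendsto_of_tendsto_of_tendsto_of_le_of_le tendsto_const_nhds ?_ (fun _ => zero_le) hle
    simpa using ENNReal.Tendsto.const_mul hL (Or.inr (ENNReal.ofReal_ne_top (r := B)))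
  have hC0 : ∀ z, |k z| ≤ |C| := fun z => (hC z).trans (le_abs_self C)
  have hexpB : ∀ s : ℝ, ∃ B, ∀ z, |Real.exp (s * k z) - 1| ≤ B := fun s =>
    ⟨Real.exp (|s| * |C|) + 1, fun z => by
      refine (abs_sub _ _).trans ?_
      rw [Real.abs_exp, abs_one]
      refine add_le_add_left (Real.exp_le_exp.2 ((le_abs_self _).trans ?_)) 1
      rw [abs_mul]
      exact mul_le_mul_of_nonneg_left (hC0 z) (abs_nonneg s)⟩
  -- compare `h n` with `h n + s k` and let `n` tend to infinity
  have hstep : ∀ s : ℝ, s * ∫ z, k z ∂ξ ≤ ∫ z, (Real.exp (s * k z) - 1) * ρ z ∂τ := by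
    intro s
    have hm : Measurable (fun z => Real.exp (s * k z) - 1) := by fun_prop
    have h1 := (hlim _ hm (hexpB s)).add hδ
    rw [add_zero] at h1
    refine ge_of_tendsto' h1 fun n => ?_
    have hmem : h n + s • k ∈ V := V.add_mem (hhV n) (V.smul_mem s hk)
    have h2 := hM _ hmem
    have h3 := hh n
    have e1 : ∫ z, (h n + s • k) z ∂ξ = ∫ z, h n z ∂ξ + s * ∫ z, k z ∂ξ := by
      simp only [Pi.add_apply, Pi.smul_apply, smul_eq_mul]
      rw [integral_add (hV.integrable (hhV n)) ((hV.integrable hk).const_mul s),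
        integral_const_mul]
    have e2 : ∫ z, Real.exp ((h n + s • k) z) ∂τ =
        ∫ z, (Real.exp (s * k z) - 1) * Real.exp (h n z) ∂τ + ∫ z, Real.exp (h n z) ∂τ := by
      rw [← integral_add (hbddint (hV.integrable_exp (hhV n)) hm (hexpB s))
        (hV.integrable_exp (hhV n))]
      congr 1 with z
      simp only [Pi.add_apply, Pi.smul_apply, smul_eq_mul, Real.exp_add]
      ring
    simp only [logDual] at h2 h3
    rw [e1, e2] at h2
    linarith
  have hkρ : Integrable (fun z => k z * ρ z) τ := hbddint hρ hkm ⟨C, hC⟩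
  have hk2ρ : Integrable (fun z => k z ^ 2 * ρ z) τ := hbddint hρ (hkm.pow_const 2)
    ⟨C ^ 2, fun z => by rw [abs_pow]; exact pow_le_pow_left₀ (abs_nonneg _) (hC z) 2⟩
  have := eq_zero_of_forall_mul_le_sq (a := ∫ z, k z ∂ξ - ∫ z, k z * ρ z ∂τ)
    (B := ∫ z, k z ^ 2 * ρ z ∂τ) (r := 1 / (|C| + 1)) (by positivity) fun s hs => by
      have h1 := hstep s
      have h2 : ∫ z, (Real.exp (s * k z) - 1) * ρ z ∂τ ≤
          ∫ z, (s * (k z * ρ z) + s ^ 2 * (k z ^ 2 * ρ z)) ∂τ := by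
        refine integral_mono (hbddint hρ (by fun_prop) (hexpB s))
          ((hkρ.const_mul s).add (hk2ρ.const_mul _)) fun z => ?_
        have hsk : |s * k z| ≤ 1 := by
          rw [abs_mul]
          calc |s| * |k z| ≤ 1 / (|C| + 1) * (|C| + 1) := by
                gcongr; linarith [hC0 z]
            _ = 1 := by field_simp
        have h3 := le_of_abs_le (Real.abs_exp_sub_one_sub_id_le hsk)
        have := mul_le_mul_of_nonneg_right h3 (hρ0 z)
        show (Real.exp (s * k z) - 1) * ρ z ≤ s * (k z * ρ z) + s ^ 2 * (k z ^ 2 * ρ z)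
        nlinarith
      rw [integral_add (hkρ.const_mul s) (hk2ρ.const_mul _), integral_const_mul,
        integral_const_mul] at h2
      linarith
  linarith

/-- A difference-quotient version of `klFun`, to which it tends as `r → 0`. -/
noncomputable def klFunQuot (r v : ℝ) : ℝ := (v - v ^ (1 - r)) / r - v + 1

lemma klFunQuot_exp (r h : ℝ) :
    klFunQuot r (Real.exp h) = (Real.exp h - Real.exp ((1 - r) * h)) / r - Real.exp h + 1 := by
  rw [klFunQuot, ← Real.exp_mul, mul_comm h]

/-- By convexity of `exp`, `exp ((1 - r) h) ≤ (1 - r) exp h + r`. -/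
lemma klFunQuot_exp_nonneg {r : ℝ} (hr : 0 < r) (hr1 : r < 1) (h : ℝ) :
    0 ≤ klFunQuot r (Real.exp h) := by
  rw [klFunQuot_exp]
  have := convexOn_exp.2 (mem_univ h) (mem_univ 0) (sub_pos.2 hr1).le hr.le (by ring)
  simp only [smul_eq_mul, mul_zero, add_zero, Real.exp_zero, mul_one] at this
  have h2 : Real.exp h - 1 ≤ (Real.exp h - Real.exp ((1 - r) * h)) / r := by
    rw [le_div_iff₀ hr]; linarith
  linarith

lemma continuous_klFunQuot {r : ℝ} (hr1 : r < 1) : Continuous (klFunQuot r) := by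
  have := Real.continuous_rpow_const (sub_pos.2 hr1).le
  unfold klFunQuot
  fun_prop

lemma tendsto_klFunQuot {v : ℝ} (hv : 0 ≤ v) {r : ℕ → ℝ} (hr : ∀ n, 0 < r n) (hr1 : ∀ n, r n < 1)
    (hr0 : Tendsto r atTop (𝓝 0)) :
    Tendsto (fun n => klFunQuot (r n) v) atTop (𝓝 (klFun v)) := by
  rcases hv.eq_or_lt with rfl | hv
  · have : ∀ n, klFunQuot (r n) 0 = klFun 0 := fun n => by
      rw [klFunQuot, Real.zero_rpow (sub_pos.2 (hr1 n)).ne', klFun_zero]; simp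
    simp_rw [this]
    exact tendsto_const_nhds
  have hd : HasDerivAt (fun t : ℝ => v ^ (1 - t)) (-(v * Real.log v)) 0 := by
    have h1 := ((Real.hasStrictDerivAt_const_rpow hv (1 - 0)).hasDerivAt).comp_const_sub 1 0
    simpa using h1
  have hs := hd.tendsto_slope_zero
  have hr' : Tendsto r atTop (𝓝[≠] 0) :=
    tendsto_nhdsWithin_iff.2 ⟨hr0, Eventually.of_forall fun n => (hr n).ne'⟩
  have h2 := ((hs.comp hr').neg.sub_const v).add_const 1
  have e : ∀ n, klFunQuot (r n) v =
      -((fun t => t⁻¹ • (v ^ (1 - (0 + t)) - v ^ (1 - (0 : ℝ)))) ∘ r) n - v + 1 := fun n => by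
    simp only [klFunQuot, Function.comp, smul_eq_mul, zero_add, sub_zero, Real.rpow_one]
    ring
  simp_rw [e]
  convert h2 using 2
  rw [klFun_apply]; ring

/-- The entropy of the limit density is at most the dual value: no duality gap. The competitors
`(1 - r) h` turn near-optimality of `h` into a bound for a difference quotient of the entropy. -/
lemma lintegral_klFun_limit_le (hV : IsTestSpace V) {M : ℝ} (hM : ∀ h ∈ V, logDual ξ τ h ≤ M)
    {h : ℕ → Z → ℝ} {ρ : Z → ℝ} {δ : ℕ → ℝ} (hδ : Tendsto δ atTop (𝓝 0))
    (hhV : ∀ n, h n ∈ V) (hh : ∀ n, M - δ n ≤ logDual ξ τ (h n)) (hρm : Measurable ρ)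
    (hρ0 : ∀ z, 0 ≤ ρ z)
    (hlim : ∀ᵐ z ∂τ, Tendsto (fun n => Real.exp (h n z)) atTop (𝓝 (ρ z))) :
    ∫⁻ z, ENNReal.ofReal (klFun (ρ z)) ∂τ ≤ ENNReal.ofReal (M + τ.real univ) := by
  have hquot : ∀ r : ℝ, 0 < r → r < 1 →
      ∫⁻ z, ENNReal.ofReal (klFunQuot r (ρ z)) ∂τ ≤ ENNReal.ofReal (M + τ.real univ) := by
    intro r hr hr1
    have ha : Tendsto (fun n => M + τ.real univ + δ n / r) atTop (𝓝 (M + τ.real univ)) := by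
      simpa using (hδ.div_const r).const_add (M + τ.real univ)
    refine lintegral_ofReal_le_of_tendsto (f := fun n z => klFunQuot r (Real.exp (h n z)))
      (fun n => ?_) ?_ (fun n => ?_) ha
    · exact ((continuous_klFunQuot hr1).measurable.comp
        (hV.measurable _ (hhV n)).exp).aemeasurable
    · filter_upwards [hlim] with z hz
      exact ((continuous_klFunQuot hr1).tendsto _).comp hz
    · have hmem : (1 - r) • h n ∈ V := V.smul_mem _ (hhV n)
      have i1 := hV.integrable_exp (τ := τ) (hhV n)
      have i2 := hV.integrable_exp (τ := τ) hmem
      simp only [Pi.smul_apply, smul_eq_mul] at i2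
      have i0 : Integrable
          (fun z => (Real.exp (h n z) - Real.exp ((1 - r) * h n z)) / r) τ :=
        (i1.sub i2).div_const r
      have i3 : Integrable
          (fun z => (Real.exp (h n z) - Real.exp ((1 - r) * h n z)) / r - Real.exp (h n z)) τ :=
        i0.sub i1
      have i4 := i3.add (integrable_const (1 : ℝ))
      have hint : Integrable (fun z => klFunQuot r (Real.exp (h n z))) τ := by
        simp_rw [klFunQuot_exp]; exact i4
      rw [← ofReal_integral_eq_lintegral_ofReal hint
        (ae_of_all _ fun z => klFunQuot_exp_nonneg hr hr1 _)]
      refine ENNReal.ofReal_le_ofReal ?_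
      have e : ∫ z, klFunQuot r (Real.exp (h n z)) ∂τ =
          (∫ z, Real.exp (h n z) ∂τ - ∫ z, Real.exp ((1 - r) * h n z) ∂τ) / r
            - ∫ z, Real.exp (h n z) ∂τ + τ.real univ := by
        simp_rw [klFunQuot_exp]
        rw [integral_add i3 (integrable_const 1), integral_sub i0 i1,
          integral_div, integral_sub i1 i2]
        simp
      have h1 := hM _ hmem
      have h2 := hh n
      have h3 := hM _ (hhV n)
      have e1 : ∫ z, ((1 - r) • h n) z ∂ξ = (1 - r) * ∫ z, h n z ∂ξ := by
        simp only [Pi.smul_apply, smul_eq_mul]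
        rw [integral_const_mul]
      simp only [logDual] at h1 h2 h3
      rw [e1] at h1
      simp only [Pi.smul_apply, smul_eq_mul] at h1
      have h4 : (∫ z, Real.exp (h n z) ∂τ - ∫ z, Real.exp ((1 - r) * h n z) ∂τ) / r ≤
          ∫ z, h n z ∂ξ + δ n / r := by
        rw [div_le_iff₀ hr, add_mul, div_mul_cancel₀ _ hr.ne']
        linarith
      rw [e]
      linarith
  have hr0 : Tendsto (fun n : ℕ => 1 / ((n : ℝ) + 1 + 1)) atTop (𝓝 0) := by
    have := (tendsto_one_div_add_atTop_nhds_zero_nat (𝕜 := ℝ)).comp (tendsto_add_atTop_nat 1)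
    simpa [Function.comp_def] using this
  have hrpos : ∀ n : ℕ, 0 < 1 / ((n : ℝ) + 1 + 1) := fun n => by positivity
  have hrlt : ∀ n : ℕ, 1 / ((n : ℝ) + 1 + 1) < 1 := fun n => by
    rw [div_lt_one (by positivity)]; linarith [n.cast_nonneg (α := ℝ)]
  exact lintegral_ofReal_le_of_tendsto
    (fun n => ((continuous_klFunQuot (hrlt n)).measurable.comp hρm).aemeasurable)
    (ae_of_all _ fun z => tendsto_klFunQuot (hρ0 z) hrpos hrlt hr0)
    (fun n => hquot _ (hrpos n) (hrlt n)) tendsto_const_nhds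

end AbstractDual

/-! ### The duality gap of a plan and a pair of potentials -/

section Gap

variable {Z : Type*} [MeasurableSpace Z]

/-- The measure with density `ρ` with respect to `ξ`, for a real density `ρ`. -/
noncomputable def ofDensity (ξ : Measure Z) (ρ : Z → ℝ) : Measure Z :=
  ξ.withDensity (fun z => ENNReal.ofReal (ρ z))

lemma integrable_ofDensity_iff {ξ : Measure Z} {ρ : Z → ℝ} (hρ : Measurable ρ)
    (hρ0 : ∀ z, 0 ≤ ρ z) {k : Z → ℝ} :
    Integrable k (ofDensity ξ ρ) ↔ Integrable (fun z => k z * ρ z) ξ := by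
  rw [ofDensity, integrable_withDensity_iff hρ.ennreal_ofReal (by simp)]
  simp_rw [ENNReal.toReal_ofReal (hρ0 _)]

lemma integral_ofDensity {ξ : Measure Z} {ρ : Z → ℝ} (hρ : Measurable ρ)
    (hρ0 : ∀ z, 0 ≤ ρ z) (k : Z → ℝ) :
    ∫ z, k z ∂(ofDensity ξ ρ) = ∫ z, k z * ρ z ∂ξ := by
  rw [ofDensity, integral_withDensity_eq_integral_toReal_smul hρ.ennreal_ofReal (by simp)]
  simp_rw [ENNReal.toReal_ofReal (hρ0 _), smul_eq_mul, mul_comm]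

lemma ofDensity_univ {ξ : Measure Z} {ρ : Z → ℝ} (hρi : Integrable ρ ξ)
    (hρ0 : ∀ z, 0 ≤ ρ z) : ofDensity ξ ρ univ = ENNReal.ofReal (∫ z, ρ z ∂ξ) := by
  rw [ofDensity, withDensity_apply _ MeasurableSet.univ, Measure.restrict_univ,
    ofReal_integral_eq_lintegral_ofReal hρi (ae_of_all _ hρ0)]

lemma integrable_of_isFiniteMeasure_ofDensity {ξ : Measure Z} {ρ : Z → ℝ} (hρ : Measurable ρ)
    (hρ0 : ∀ z, 0 ≤ ρ z) [IsFiniteMeasure (ofDensity ξ ρ)] : Integrable ρ ξ := by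
  simpa using (integrable_ofDensity_iff hρ hρ0).1 (integrable_const (1 : ℝ))

/-- The density `exp ((f + g - c) / ε)` of the plan recovered from potentials `f` and `g`. -/
noncomputable def gibbsDensity {X Y : Type*} (c : X × Y → ℝ≥0) (ε : ℝ) (f : X → ℝ) (g : Y → ℝ)
    (z : X × Y) : ℝ :=
  Real.exp ((f z.1 + g z.2 - c z) / ε)

lemma gibbsDensity_pos {X Y : Type*} (c : X × Y → ℝ≥0) (ε : ℝ) (f : X → ℝ)
    (g : Y → ℝ) (z : X × Y) :
    0 < gibbsDensity c ε f g z := Real.exp_pos _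

lemma gibbsDensity_zero_le_one {X Y : Type*} {c : X × Y → ℝ≥0} {ε : ℝ} (hε : 0 < ε)
    (z : X × Y) : gibbsDensity c ε 0 0 z ≤ 1 := by
  simp only [gibbsDensity, Pi.zero_apply]
  rw [Real.exp_le_one_iff]
  exact div_nonpos_of_nonpos_of_nonneg (by simp) hε.le

lemma gibbsDensity_smul {X Y : Type*} {c : X × Y → ℝ≥0} {ε : ℝ} (hε : 0 < ε)
    (f : X → ℝ) (g : Y → ℝ) (z : X × Y) :
    gibbsDensity c ε (ε • f) (ε • g) z = Real.exp (f z.1 + g z.2) * gibbsDensity c ε 0 0 z := by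
  rw [gibbsDensity, gibbsDensity, ← Real.exp_add]
  congr 1
  simp only [Pi.smul_apply, smul_eq_mul, Pi.zero_apply]
  field_simp
  ring

variable {X Y : Type*} [MeasurableSpace X] [MeasurableSpace Y]

lemma primalObjective_ofDensity {c : X × Y → ℝ≥0} (hc : Measurable c) {ξ : Measure (X × Y)}
    [IsFiniteMeasure ξ] {ε : ℝ} (hε : 0 < ε) {ρ : X × Y → ℝ} (hρ : Measurable ρ)
    (hρ0 : ∀ z, 0 ≤ ρ z) (hρi : Integrable ρ ξ) :
    primalObjective c ξ ε (ofDensity ξ ρ) =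
      ∫⁻ z, ENNReal.ofReal (c z * ρ z + ε * klFun (ρ z)) ∂ξ := by
  have : IsFiniteMeasure (ofDensity ξ ρ) := isFiniteMeasure_withDensity_ofReal hρi.2
  have hkl : klDiv (ofDensity ξ ρ) ξ = ∫⁻ z, ENNReal.ofReal (klFun (ρ z)) ∂ξ := by
    rw [klDiv_eq_lintegral_klFun_of_ac (μ := ofDensity ξ ρ) (withDensity_absolutelyContinuous _ _)]
    refine lintegral_congr_ae ?_
    filter_upwards [Measure.rnDeriv_withDensity ξ hρ.ennreal_ofReal] with z hz
    rw [ofDensity, hz, ENNReal.toReal_ofReal (hρ0 z)]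
  have hm : Measurable (fun z => ENNReal.ofReal (klFun (ρ z))) :=
    (measurable_klFun.comp hρ).ennreal_ofReal
  rw [primalObjective, hkl, ofDensity, lintegral_withDensity_eq_lintegral_mul _
    hρ.ennreal_ofReal hc.coe_nnreal_ennreal, ← lintegral_const_mul _ hm,
    ← lintegral_add_right _ (hm.const_mul _)]
  refine lintegral_congr fun z => ?_
  rw [ENNReal.ofReal_add (mul_nonneg (c z).coe_nonneg (hρ0 z))
      (mul_nonneg hε.le (klFun_nonneg (hρ0 z))),
    ENNReal.ofReal_mul hε.le, Pi.mul_apply, mul_comm, ENNReal.ofReal_mul (c z).coe_nonneg]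
  simp

/-- Plans of finite cost have a density with respect to the reference plan. -/
lemma exists_density {c : X × Y → ℝ≥0} {ξ π : Measure (X × Y)} [IsFiniteMeasure ξ]
    [IsFiniteMeasure π] {ε : ℝ} (hε : 0 < ε) (h : primalObjective c ξ ε π ≠ ∞) :
    ∃ ρ : X × Y → ℝ, Measurable ρ ∧ (∀ z, 0 ≤ ρ z) ∧ Integrable ρ ξ ∧ π = ofDensity ξ ρ := by
  have hkl : klDiv π ξ ≠ ∞ := fun h' => h (by
    rw [primalObjective, h', ENNReal.mul_top (by simpa using hε), add_top])
  have hac : π ≪ ξ := (klDiv_ne_top_iff.1 hkl).1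
  refine ⟨fun z => (π.rnDeriv ξ z).toReal, (Measure.measurable_rnDeriv _ _).ennreal_toReal,
    fun z => ENNReal.toReal_nonneg, Measure.integrable_toReal_rnDeriv, ?_⟩
  rw [ofDensity]
  conv_lhs => rw [← Measure.withDensity_rnDeriv_eq π ξ hac]
  refine withDensity_congr_ae ?_
  filter_upwards [Measure.rnDeriv_lt_top π ξ] with z hz
  rw [ENNReal.ofReal_toReal hz.ne]

lemma integrable_add_of_mem_plans {μ : Measure X} {ν : Measure Y} {π : Measure (X × Y)}
    (hπ : π ∈ plans μ ν) {f : X → ℝ} {g : Y → ℝ} (hf : Integrable f μ) (hg : Integrable g ν) :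
    Integrable (fun z => f z.1 + g z.2) π := by
  rw [← hπ.1] at hf
  rw [← hπ.2] at hg
  exact (hf.comp_measurable measurable_fst).add (hg.comp_measurable measurable_snd)

lemma integral_add_of_mem_plans {μ : Measure X} {ν : Measure Y} {π : Measure (X × Y)}
    (hπ : π ∈ plans μ ν) {f : X → ℝ} {g : Y → ℝ} (hf : Integrable f μ) (hg : Integrable g ν) :
    ∫ z, (f z.1 + g z.2) ∂π = ∫ x, f x ∂μ + ∫ y, g y ∂ν := by
  rw [← hπ.1] at hf ⊢
  rw [← hπ.2] at hg ⊢
  rw [integral_map measurable_fst.aemeasurable hf.1, integral_map measurable_snd.aemeasurable hg.1]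
  exact integral_add (hf.comp_measurable measurable_fst) (hg.comp_measurable measurable_snd)

lemma recoveredPlan_eq_ofDensity (c : X × Y → ℝ≥0) (ξ : Measure (X × Y)) (ε : ℝ) (f : X → ℝ)
    (g : Y → ℝ) : recoveredPlan c ξ ε f g = ofDensity ξ (gibbsDensity c ε f g) := rfl

lemma measurable_gibbsDensity {c : X × Y → ℝ≥0} (hc : Measurable c) (ε : ℝ) {f : X → ℝ}
    {g : Y → ℝ} (hf : Measurable f) (hg : Measurable g) : Measurable (gibbsDensity c ε f g) := by
  unfold gibbsDensity
  fun_prop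

variable {μ : Measure X} {ν : Measure Y} {c : X × Y → ℝ≥0} {ξ : Measure (X × Y)} {ε : ℝ}

lemma measurable_gibbsDensity_zero (hc : Measurable c) : Measurable (gibbsDensity c ε 0 0) :=
  measurable_gibbsDensity hc ε measurable_zero measurable_zero

lemma aestronglyMeasurable_gibbsDensity (hc : Measurable c) (hξ : ξ ∈ plans μ ν) {f : X → ℝ}
    {g : Y → ℝ} (hf : Integrable f μ) (hg : Integrable g ν) :
    AEStronglyMeasurable (gibbsDensity c ε f g) ξ := by
  have h1 := (integrable_add_of_mem_plans hξ hf hg).1.aemeasurable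
  exact (Real.measurable_exp.comp_aemeasurable
    ((h1.sub hc.coe_nnreal_real.aemeasurable).div_const ε)).aestronglyMeasurable

lemma dualObjective_eq_coe (hε : 0 < ε) {f : X → ℝ} {g : Y → ℝ}
    (hi : Integrable (gibbsDensity c ε f g) ξ) :
    dualObjective μ ν c ξ ε f g =
      ((∫ x, f x ∂μ + ∫ y, g y ∂ν - ε * ∫ z, gibbsDensity c ε f g z ∂ξ : ℝ) : EReal) := by
  have h0 : 0 ≤ ∫ z, gibbsDensity c ε f g z ∂ξ :=
    integral_nonneg fun z => (gibbsDensity_pos c ε f g z).le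
  have h1 : ENNReal.ofReal ε * ∫⁻ z, ENNReal.ofReal (Real.exp ((f z.1 + g z.2 - c z) / ε)) ∂ξ =
      ENNReal.ofReal (ε * ∫ z, gibbsDensity c ε f g z ∂ξ) := by
    rw [ENNReal.ofReal_mul hε.le, ofReal_integral_eq_lintegral_ofReal hi
      (ae_of_all _ fun z => (gibbsDensity_pos c ε f g z).le)]
    rfl
  rw [dualObjective, h1, EReal.coe_ennreal_ofReal, max_eq_left (mul_nonneg hε.le h0)]
  norm_cast

lemma dualObjective_eq_bot (hc : Measurable c) (hξ : ξ ∈ plans μ ν) (hε : 0 < ε) {f : X → ℝ}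
    {g : Y → ℝ} (hf : Integrable f μ) (hg : Integrable g ν)
    (hi : ¬ Integrable (gibbsDensity c ε f g) ξ) : dualObjective μ ν c ξ ε f g = ⊥ := by
  have h1 : ∫⁻ z, ENNReal.ofReal (Real.exp ((f z.1 + g z.2 - c z) / ε)) ∂ξ = ∞ := by
    by_contra h
    exact hi ((lintegral_ofReal_ne_top_iff_integrable
      (aestronglyMeasurable_gibbsDensity hc hξ hf hg)
      (ae_of_all _ fun z => (gibbsDensity_pos c ε f g z).le)).1 h)
  rw [dualObjective, h1, ENNReal.mul_top (by simpa using hε)]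
  simp

/-- Young's inequality `a ρ ≤ ρ log ρ - ρ + exp a`, with a quadratic remainder. It reduces to
`w + 1 ≤ exp w` for `w = (a - log ρ) / 2`. -/
lemma mul_add_sq_sub_le_klFun {ρ : ℝ} (hρ : 0 ≤ ρ) (a : ℝ) :
    a * ρ + (√ρ - √(Real.exp a)) ^ 2 ≤ klFun ρ - 1 + Real.exp a := by
  rw [klFun_apply]
  have h1 : √(Real.exp a) = Real.exp (a / 2) := by rw [Real.exp_half]
  have h2 : Real.exp (a / 2) ^ 2 = Real.exp a := by rw [← Real.exp_nat_mul]; ring_nf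
  rcases hρ.eq_or_lt with rfl | hρ
  · simp [h1, h2]
  · rw [h1]
    have h3 : √ρ = Real.exp (Real.log ρ / 2) := by rw [Real.exp_half, Real.exp_log hρ]
    have h4 : √ρ ^ 2 = ρ := Real.sq_sqrt hρ.le
    have h5 := Real.add_one_le_exp ((a - Real.log ρ) / 2)
    have h6 : Real.exp (a / 2) = √ρ * Real.exp ((a - Real.log ρ) / 2) := by
      rw [h3, ← Real.exp_add]; ring_nf
    have h7 : ρ * ((a - Real.log ρ) / 2 + 1) ≤ √ρ * Real.exp (a / 2) := by
      rw [h6, ← mul_assoc, ← sq, h4]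
      exact mul_le_mul_of_nonneg_left h5 hρ.le
    nlinarith

/-- Quantitative weak duality: the gap between the cost of a plan and the dual objective
controls the Hellinger distance between the plan and the plan recovered from the potentials. -/
lemma dual_add_hellinger_le (hc : Measurable c) [IsProbabilityMeasure ξ] (hε : 0 < ε)
    {ρ : X × Y → ℝ} (hρ : Measurable ρ) (hρ0 : ∀ z, 0 ≤ ρ z) (hρi : Integrable ρ ξ)
    (hπ : ofDensity ξ ρ ∈ plans μ ν) (hP : primalObjective c ξ ε (ofDensity ξ ρ) ≠ ∞)
    {f : X → ℝ} {g : Y → ℝ} (hf : Integrable f μ) (hg : Integrable g ν)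
    (hi : Integrable (gibbsDensity c ε f g) ξ) :
    Integrable (fun z => (√(ρ z) - √(gibbsDensity c ε f g z)) ^ 2) ξ ∧
      ∫ x, f x ∂μ + ∫ y, g y ∂ν - ε * ∫ z, gibbsDensity c ε f g z ∂ξ + ε +
        ε * ∫ z, (√(ρ z) - √(gibbsDensity c ε f g z)) ^ 2 ∂ξ
        ≤ (primalObjective c ξ ε (ofDensity ξ ρ)).toReal := by
  rw [primalObjective_ofDensity hc hε hρ hρ0 hρi] at hP ⊢
  have hnn : ∀ z, 0 ≤ c z * ρ z + ε * klFun (ρ z) := fun z =>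
    add_nonneg (mul_nonneg (c z).coe_nonneg (hρ0 z)) (mul_nonneg hε.le (klFun_nonneg (hρ0 z)))
  have hm : Measurable (fun z => c z * ρ z + ε * klFun (ρ z)) :=
    (hc.coe_nnreal_real.mul hρ).add ((measurable_klFun.comp hρ).const_mul ε)
  have hPi : Integrable (fun z => c z * ρ z + ε * klFun (ρ z)) ξ :=
    (lintegral_ofReal_ne_top_iff_integrable hm.aestronglyMeasurable (ae_of_all _ hnn)).1 hP
  rw [← ofReal_integral_eq_lintegral_ofReal hPi (ae_of_all _ hnn),
    ENNReal.toReal_ofReal (integral_nonneg hnn)]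
  have hfgπ := integrable_add_of_mem_plans hπ hf hg
  have hfg : Integrable (fun z => (f z.1 + g z.2) * ρ z) ξ :=
    (integrable_ofDensity_iff hρ hρ0).1 hfgπ
  have hfgi := integral_ofDensity (ξ := ξ) hρ hρ0 (fun z => f z.1 + g z.2)
  rw [integral_add_of_mem_plans hπ hf hg] at hfgi
  have hsq : Integrable (fun z => (√(ρ z) - √(gibbsDensity c ε f g z)) ^ 2) ξ := by
    refine Integrable.mono' ((hρi.add hi).const_mul 2) ?_ (ae_of_all _ fun z => ?_)
    · exact ((hρ.sqrt.aemeasurable.sub hi.1.aemeasurable.sqrt).pow_const 2).aestronglyMeasurable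
    · rw [Real.norm_of_nonneg (sq_nonneg _)]
      have h1 := Real.sq_sqrt (hρ0 z)
      have h2 := Real.sq_sqrt (gibbsDensity_pos c ε f g z).le
      show _ ≤ 2 * (ρ z + gibbsDensity c ε f g z)
      nlinarith [sq_nonneg (√(ρ z) + √(gibbsDensity c ε f g z))]
  refine ⟨hsq, ?_⟩
  have hmono : ∫ z, ((f z.1 + g z.2) * ρ z + ε * (√(ρ z) - √(gibbsDensity c ε f g z)) ^ 2) ∂ξ ≤
      ∫ z, (c z * ρ z + ε * klFun (ρ z) - ε + ε * gibbsDensity c ε f g z) ∂ξ := by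
    refine integral_mono (hfg.add (hsq.const_mul ε))
      ((hPi.sub (integrable_const ε)).add (hi.const_mul ε)) fun z => ?_
    have h1 := mul_add_sq_sub_le_klFun (hρ0 z) ((f z.1 + g z.2 - c z) / ε)
    have h2 := mul_le_mul_of_nonneg_left h1 hε.le
    have h3 : ε * ((f z.1 + g z.2 - c z) / ε * ρ z) = (f z.1 + g z.2 - c z) * ρ z := by
      field_simp
    rw [mul_add, h3] at h2
    change (f z.1 + g z.2) * ρ z + ε * (√(ρ z) - √(gibbsDensity c ε f g z)) ^ 2 ≤
      c z * ρ z + ε * klFun (ρ z) - ε + ε * gibbsDensity c ε f g z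
    simp only [gibbsDensity]
    linarith
  have hPi' : Integrable (fun z => c z * ρ z + ε * klFun (ρ z) - ε) ξ :=
    hPi.sub (integrable_const ε)
  rw [integral_add hfg (hsq.const_mul ε), integral_add hPi' (hi.const_mul ε),
    integral_sub hPi (integrable_const ε), integral_const_mul, integral_const_mul, ← hfgi] at hmono
  simp only [integral_const, probReal_univ, one_smul] at hmono
  linarith

/-- Weak duality. -/
lemma dualObjective_add_le (hc : Measurable c) [IsProbabilityMeasure ξ] (hξ : ξ ∈ plans μ ν)
    (hε : 0 < ε) {π : Measure (X × Y)} [IsFiniteMeasure π] (hπ : π ∈ plans μ ν)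
    {f : X → ℝ} {g : Y → ℝ} (hf : Integrable f μ) (hg : Integrable g ν) :
    dualObjective μ ν c ξ ε f g + (ε : EReal) ≤ (primalObjective c ξ ε π : EReal) := by
  by_cases hi : Integrable (gibbsDensity c ε f g) ξ
  swap
  · rw [dualObjective_eq_bot hc hξ hε hf hg hi, EReal.bot_add]
    exact bot_le
  by_cases hP : primalObjective c ξ ε π = ∞
  · rw [hP]; exact le_top
  obtain ⟨ρ, hρ, hρ0, hρi, rfl⟩ := exists_density hε hP
  have h1 := (dual_add_hellinger_le hc hε hρ hρ0 hρi hπ hP hf hg hi).2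
  have h2 : 0 ≤ ε * ∫ z, (√(ρ z) - √(gibbsDensity c ε f g z)) ^ 2 ∂ξ :=
    mul_nonneg hε.le (integral_nonneg fun z => sq_nonneg _)
  rw [dualObjective_eq_coe hε hi, ← EReal.coe_ennreal_toReal hP]
  norm_cast
  linarith

/-- Complementary slackness: if the recovered plan is a coupling, there is no duality gap. -/
lemma dualObjective_add_eq_of_mem_plans (hc : Measurable c) [IsProbabilityMeasure μ]
    [IsProbabilityMeasure ξ] (hε : 0 < ε) {f : X → ℝ} {g : Y → ℝ} (hfm : Measurable f)
    (hgm : Measurable g) (hf : Integrable f μ) (hg : Integrable g ν)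
    (hπ : recoveredPlan c ξ ε f g ∈ plans μ ν) :
    dualObjective μ ν c ξ ε f g + (ε : EReal) =
      (primalObjective c ξ ε (recoveredPlan c ξ ε f g) : EReal) := by
  have := isProbabilityMeasure_of_mem_plans hπ
  rw [recoveredPlan_eq_ofDensity] at *
  have hρ := measurable_gibbsDensity hc ε hfm hgm
  have hρ0 : ∀ z, 0 ≤ gibbsDensity c ε f g z := fun z => (gibbsDensity_pos c ε f g z).le
  have hi := integrable_of_isFiniteMeasure_ofDensity (ξ := ξ) hρ hρ0
  have hone : ∫ z, gibbsDensity c ε f g z ∂ξ = 1 := by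
    have h := ofDensity_univ hi hρ0
    rw [measure_univ] at h
    exact ((ENNReal.ofReal_eq_one).1 h.symm)
  have hfg : Integrable (fun z => (f z.1 + g z.2) * gibbsDensity c ε f g z) ξ :=
    (integrable_ofDensity_iff hρ hρ0).1 (integrable_add_of_mem_plans hπ hf hg)
  have hfgi := integral_ofDensity (ξ := ξ) hρ hρ0 (fun z => f z.1 + g z.2)
  rw [integral_add_of_mem_plans hπ hf hg] at hfgi
  have e : ∀ z, c z * gibbsDensity c ε f g z + ε * klFun (gibbsDensity c ε f g z) =
      (f z.1 + g z.2) * gibbsDensity c ε f g z + ε - ε * gibbsDensity c ε f g z := fun z => by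
    have h : ε * Real.log (gibbsDensity c ε f g z) = f z.1 + g z.2 - c z := by
      rw [gibbsDensity, Real.log_exp]; field_simp
    rw [klFun_apply]
    linear_combination gibbsDensity c ε f g z * h
  have hnn : ∀ z, 0 ≤ c z * gibbsDensity c ε f g z + ε * klFun (gibbsDensity c ε f g z) :=
    fun z => add_nonneg (mul_nonneg (c z).coe_nonneg (hρ0 z))
      (mul_nonneg hε.le (klFun_nonneg (hρ0 z)))
  have i1 : Integrable (fun z => (f z.1 + g z.2) * gibbsDensity c ε f g z + ε) ξ :=
    hfg.add (integrable_const ε)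
  have hint : Integrable (fun z => c z * gibbsDensity c ε f g z +
      ε * klFun (gibbsDensity c ε f g z)) ξ := by
    simp_rw [e]
    exact i1.sub (hi.const_mul ε)
  have hval : ∫ z, (c z * gibbsDensity c ε f g z + ε * klFun (gibbsDensity c ε f g z)) ∂ξ =
      ∫ x, f x ∂μ + ∫ y, g y ∂ν - ε * ∫ z, gibbsDensity c ε f g z ∂ξ + ε := by
    simp_rw [e]
    rw [integral_sub i1 (hi.const_mul ε), integral_add hfg (integrable_const ε),
      integral_const_mul, ← hfgi]
    simp only [integral_const, probReal_univ, one_smul]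
    ring
  rw [primalObjective_ofDensity hc hε hρ hρ0 hi, dualObjective_eq_coe hε hi,
    ← ofReal_integral_eq_lintegral_ofReal hint (ae_of_all _ hnn), EReal.coe_ennreal_ofReal,
    max_eq_left (integral_nonneg hnn), hval]
  norm_cast

end Gap

/-! ### Optimal plans as limits of dual maximizing sequences -/

section Existence

lemma dualObjective_le_dualValue {X Y : Type*} [TopologicalSpace X]
    [MeasurableSpace X] [TopologicalSpace Y] [MeasurableSpace Y] {μ : Measure X} {ν : Measure Y}
    {c : X × Y → ℝ≥0} {ξ : Measure (X × Y)} {ε : ℝ} (f : C(X, ℝ)) (g : C(Y, ℝ))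
    (hf : Integrable f μ) (hg : Integrable g ν) :
    dualObjective μ ν c ξ ε f g ≤ dualValue μ ν c ξ ε :=
  le_iSup_of_le f (le_iSup_of_le g (le_iSup_of_le hf (le_iSup_of_le hg le_rfl)))

/-- If the integrals of `s - exp s` stay bounded below along a sequence for which `exp s`
converges, then the limit is positive and `s` converges to its logarithm, which is integrable. -/
lemma tendsto_log_of_integral_sub_exp_ge {Z : Type*} [MeasurableSpace Z] {ξ : Measure Z}
    {s : ℕ → Z → ℝ} {ρ : Z → ℝ} (hsm : ∀ n, Measurable (s n))
    (hs : ∀ n, Integrable (s n) ξ)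
    (hes : ∀ n, Integrable (fun z => Real.exp (s n z)) ξ) {K : ℝ}
    (hK : ∀ n, K ≤ ∫ z, s n z ∂ξ - ∫ z, Real.exp (s n z) ∂ξ) (hρm : Measurable ρ)
    (hρ0 : ∀ z, 0 ≤ ρ z) (hρ : Integrable ρ ξ)
    (hlim : ∀ᵐ z ∂ξ, Tendsto (fun n => Real.exp (s n z)) atTop (𝓝 (ρ z))) :
    (∀ᵐ z ∂ξ, 0 < ρ z ∧ Tendsto (fun n => s n z) atTop (𝓝 (Real.log (ρ z)))) ∧
      Integrable (fun z => Real.log (ρ z)) ξ := by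
  have hnn : ∀ t : ℝ, 0 ≤ Real.exp t - t := fun t => by linarith [Real.add_one_le_exp t]
  have hint : ∀ n, Integrable (fun z => Real.exp (s n z) - s n z) ξ := fun n =>
    (hes n).sub (hs n)
  have hle : ∀ n, ∫⁻ z, ENNReal.ofReal (Real.exp (s n z) - s n z) ∂ξ ≤ ENNReal.ofReal (-K) := by
    intro n
    rw [← ofReal_integral_eq_lintegral_ofReal (hint n) (ae_of_all _ fun z => hnn _),
      integral_sub (hes n) (hs n)]
    exact ENNReal.ofReal_le_ofReal (by linarith [hK n])
  have hmeas : ∀ n, Measurable (fun z => ENNReal.ofReal (Real.exp (s n z) - s n z)) := fun n =>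
    ((hsm n).exp.sub (hsm n)).ennreal_ofReal
  have hfatou : ∫⁻ z, liminf (fun n => ENNReal.ofReal (Real.exp (s n z) - s n z)) atTop ∂ξ ≠ ∞ := by
    refine ne_top_of_le_ne_top (ENNReal.ofReal_ne_top (r := -K)) ?_
    exact (lintegral_liminf_le hmeas).trans ((liminf_le_liminf (Eventually.of_forall hle)).trans_eq
      (liminf_const (ENNReal.ofReal (-K))))
  have hae : ∀ᵐ z ∂ξ, 0 < ρ z ∧ Tendsto (fun n => s n z) atTop (𝓝 (Real.log (ρ z))) := by
    filter_upwards [hlim, ae_lt_top (Measurable.liminf hmeas) hfatou] with z hz hzt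
    have hpos : 0 < ρ z := by
      -- where the limit vanishes, `s` tends to `-∞` and `exp s - s` to `∞`
      refine (hρ0 z).lt_of_ne fun h0 => hzt.ne ?_
      rw [← h0, Real.tendsto_exp_comp_nhds_zero] at hz
      have h1 : Tendsto (fun n => Real.exp (s n z) - s n z) atTop atTop :=
        tendsto_atTop_mono (fun n => by
          simp only [Function.comp]; linarith [Real.exp_pos (s n z)])
          (tendsto_neg_atBot_atTop.comp hz)
      exact (ENNReal.tendsto_ofReal_atTop.comp h1).liminf_eq
    refine ⟨hpos, ?_⟩
    simpa [Function.comp_def] using (Real.continuousAt_log hpos.ne').tendsto.comp hz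
  refine ⟨hae, ?_⟩
  have h1 : ∫⁻ z, ENNReal.ofReal (ρ z - Real.log (ρ z)) ∂ξ ≤ ENNReal.ofReal (-K) :=
    lintegral_ofReal_le_of_tendsto (fun n => (hint n).1.aemeasurable)
      (by filter_upwards [hlim, hae] with z h1 h2 using h1.sub h2.2) hle tendsto_const_nhds
  have h2 : Integrable (fun z => ρ z - Real.log (ρ z)) ξ := by
    refine (lintegral_ofReal_ne_top_iff_integrable (hρm.sub hρm.log).aestronglyMeasurable
      ?_).1 (ne_top_of_le_ne_top ENNReal.ofReal_ne_top h1)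
    filter_upwards [hae] with z hz
    have := Real.log_le_sub_one_of_pos hz.1
    show 0 ≤ ρ z - Real.log (ρ z)
    linarith
  exact (hρ.sub h2).congr (ae_of_all _ fun z => sub_sub_cancel _ _)

section CostMeasure

variable {X Y : Type*} [MeasurableSpace X] [MeasurableSpace Y] {c : X × Y → ℝ≥0}
  {ξ : Measure (X × Y)} [IsProbabilityMeasure ξ] {ε : ℝ}

/-- The reference measure `exp (-c / ε) ξ`, written with the density of zero potentials. -/
noncomputable def costMeasure (c : X × Y → ℝ≥0) (ξ : Measure (X × Y)) (ε : ℝ) : Measure (X × Y) :=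
  ofDensity ξ (gibbsDensity c ε 0 0)

lemma integrable_gibbsDensity_zero (hc : Measurable c) (hε : 0 < ε) :
    Integrable (gibbsDensity c ε 0 0) ξ :=
  Integrable.of_bound (measurable_gibbsDensity_zero hc).aestronglyMeasurable 1
    (ae_of_all _ fun z => by
      rw [Real.norm_of_nonneg (gibbsDensity_pos c ε 0 0 z).le]
      exact gibbsDensity_zero_le_one hε z)

lemma isFiniteMeasure_costMeasure (hc : Measurable c) (hε : 0 < ε) :
    IsFiniteMeasure (costMeasure c ξ ε) :=
  isFiniteMeasure_withDensity_ofReal (integrable_gibbsDensity_zero hc hε).2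

lemma costMeasure_real_univ (hc : Measurable c) (hε : 0 < ε) :
    (costMeasure c ξ ε).real univ = ∫ z, gibbsDensity c ε 0 0 z ∂ξ := by
  have h0 : ∀ z, 0 ≤ gibbsDensity c ε 0 0 z := fun z => (gibbsDensity_pos c ε 0 0 z).le
  rw [Measure.real, costMeasure, ofDensity_univ (integrable_gibbsDensity_zero hc hε) h0,
    ENNReal.toReal_ofReal (integral_nonneg h0)]

lemma costMeasure_real_univ_le_one (hc : Measurable c) (hε : 0 < ε) :
    (costMeasure c ξ ε).real univ ≤ 1 := by
  rw [costMeasure_real_univ hc hε]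
  calc ∫ z, gibbsDensity c ε 0 0 z ∂ξ ≤ ∫ _, (1 : ℝ) ∂ξ :=
        integral_mono (integrable_gibbsDensity_zero hc hε) (integrable_const 1)
          (gibbsDensity_zero_le_one hε)
    _ = 1 := by simp

/-- The transport cost is absorbed into the reference measure: up to the factor `ε`, the cost of a
plan is its (unnormalized) relative entropy with respect to `exp (-c / ε) ξ`. -/
lemma primalObjective_mul_gibbsDensity (hc : Measurable c) (hε : 0 < ε) {ρ : X × Y → ℝ}
    (hρ : Measurable ρ) (hρ0 : ∀ z, 0 ≤ ρ z) (hρi : Integrable ρ (costMeasure c ξ ε)) :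
    primalObjective c ξ ε (ofDensity ξ fun z => ρ z * gibbsDensity c ε 0 0 z) =
      ENNReal.ofReal ε * (∫⁻ z, ENNReal.ofReal (klFun (ρ z)) ∂(costMeasure c ξ ε) +
        ENNReal.ofReal (1 - (costMeasure c ξ ε).real univ)) := by
  have hw := measurable_gibbsDensity_zero (ε := ε) hc
  have hw0 : ∀ z, 0 ≤ gibbsDensity c ε 0 0 z := fun z => (gibbsDensity_pos c ε 0 0 z).le
  have hwi := integrable_gibbsDensity_zero (ξ := ξ) hc hε
  have hkm : Measurable fun z => ENNReal.ofReal (klFun (ρ z)) :=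
    (measurable_klFun.comp hρ).ennreal_ofReal
  -- with `w = exp (-c / ε)`, the integrand of the cost is `ε (w klFun ρ + (1 - w))`
  have e : ∀ z, ENNReal.ofReal (c z * (ρ z * gibbsDensity c ε 0 0 z) +
      ε * klFun (ρ z * gibbsDensity c ε 0 0 z)) =
      ENNReal.ofReal ε * (ENNReal.ofReal (gibbsDensity c ε 0 0 z) * ENNReal.ofReal (klFun (ρ z)) +
        ENNReal.ofReal (1 - gibbsDensity c ε 0 0 z)) := fun z => by
    rw [← ENNReal.ofReal_mul (hw0 z), ← ENNReal.ofReal_add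
      (mul_nonneg (hw0 z) (klFun_nonneg (hρ0 z)))
      (sub_nonneg.2 (gibbsDensity_zero_le_one hε z)), ← ENNReal.ofReal_mul hε.le]
    congr 1
    have hlog : ε * Real.log (gibbsDensity c ε 0 0 z) = -c z := by
      rw [gibbsDensity, Real.log_exp]; simp; field_simp
    rcases (hρ0 z).eq_or_lt with h0 | h0
    · simp [← h0, klFun_zero]
    · rw [klFun_apply, klFun_apply, Real.log_mul h0.ne' (gibbsDensity_pos c ε 0 0 z).ne']
      linear_combination (ρ z * gibbsDensity c ε 0 0 z) * hlog
  have hint : Integrable (fun z => 1 - gibbsDensity c ε 0 0 z) ξ := (integrable_const 1).sub hwi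
  have h1w : ∫⁻ z, ENNReal.ofReal (1 - gibbsDensity c ε 0 0 z) ∂ξ =
      ENNReal.ofReal (1 - (costMeasure c ξ ε).real univ) := by
    rw [← ofReal_integral_eq_lintegral_ofReal hint
      (ae_of_all _ fun z => sub_nonneg.2 (gibbsDensity_zero_le_one hε z)),
      integral_sub (integrable_const 1) hwi, costMeasure_real_univ hc hε]
    simp
  have hkl : ∫⁻ z, ENNReal.ofReal (gibbsDensity c ε 0 0 z) * ENNReal.ofReal (klFun (ρ z)) ∂ξ =
      ∫⁻ z, ENNReal.ofReal (klFun (ρ z)) ∂(costMeasure c ξ ε) := by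
    rw [costMeasure, ofDensity, lintegral_withDensity_eq_lintegral_mul _ hw.ennreal_ofReal hkm]
    rfl
  have hm : Measurable fun z => ρ z * gibbsDensity c ε 0 0 z := hρ.mul hw
  have hm1 : Measurable fun z => ENNReal.ofReal (1 - gibbsDensity c ε 0 0 z) :=
    (measurable_const.sub hw).ennreal_ofReal
  rw [primalObjective_ofDensity hc hε hm (fun z => mul_nonneg (hρ0 z) (hw0 z))
    ((integrable_ofDensity_iff hw hw0).1 hρi), lintegral_congr e,
    lintegral_const_mul' _ _ ENNReal.ofReal_ne_top, ← hkl, ← h1w,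
    ← lintegral_add_right _ hm1]

end CostMeasure

/-- The map `(f, g) ↦ f ⊕ g` on pairs of bounded continuous potentials. -/
noncomputable def potentialSum (X Y : Type*) [TopologicalSpace X] [TopologicalSpace Y] :
    ((X →ᵇ ℝ) × (Y →ᵇ ℝ)) →ₗ[ℝ] (X × Y → ℝ) where
  toFun p z := p.1 z.1 + p.2 z.2
  map_add' p q := by ext z; simp; ring
  map_smul' r p := by ext z; simp; ring

variable {X Y : Type*} [TopologicalSpace X] [MeasurableSpace X] [BorelSpace X]
  [TopologicalSpace Y] [MeasurableSpace Y] [BorelSpace Y]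

lemma isTestSpace_potentialSum : IsTestSpace (LinearMap.range (potentialSum X Y)) where
  measurable := by
    rintro _ ⟨p, rfl⟩
    exact (p.1.continuous.measurable.comp measurable_fst).add
      (p.2.continuous.measurable.comp measurable_snd)
  bounded := by
    rintro _ ⟨p, rfl⟩
    refine ⟨‖p.1‖ + ‖p.2‖, fun z => (abs_add_le _ _).trans (add_le_add ?_ ?_)⟩
    · exact p.1.norm_coe_le_norm z.1
    · exact p.2.norm_coe_le_norm z.2

variable {μ : Measure X} {ν : Measure Y} {c : X × Y → ℝ≥0} {ξ : Measure (X × Y)}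
  [IsProbabilityMeasure ξ] {ε : ℝ}

lemma dualObjective_smul [IsProbabilityMeasure μ] [IsProbabilityMeasure ν] (hc : Measurable c)
    (hξ : ξ ∈ plans μ ν) (hε : 0 < ε) (f : X →ᵇ ℝ)
    (g : Y →ᵇ ℝ) :
    dualObjective μ ν c ξ ε (ε • f) (ε • g) =
      ((ε * logDual ξ (costMeasure c ξ ε) (potentialSum X Y (f, g)) : ℝ) : EReal) := by
  have hfin := isFiniteMeasure_costMeasure (ξ := ξ) hc hε
  have hw := measurable_gibbsDensity_zero (ε := ε) hc
  have hw0 : ∀ z, 0 ≤ gibbsDensity c ε 0 0 z := fun z => (gibbsDensity_pos c ε 0 0 z).le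
  have hi : Integrable (gibbsDensity c ε (ε • ⇑f) (ε • ⇑g)) ξ := by
    have := (integrable_ofDensity_iff hw hw0).1 (isTestSpace_potentialSum.integrable_exp
      (τ := costMeasure c ξ ε) (LinearMap.mem_range_self (potentialSum X Y) (f, g)))
    refine this.congr (ae_of_all _ fun z => ?_)
    rw [gibbsDensity_smul hε]
    rfl
  have hval : ∫ z, Real.exp (potentialSum X Y (f, g) z) ∂(costMeasure c ξ ε) =
      ∫ z, gibbsDensity c ε (ε • ⇑f) (ε • ⇑g) z ∂ξ := by
    rw [costMeasure, integral_ofDensity hw hw0]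
    congr 1 with z
    rw [gibbsDensity_smul hε]
    rfl
  have hsum : ∫ z, potentialSum X Y (f, g) z ∂ξ = ∫ x, f x ∂μ + ∫ y, g y ∂ν :=
    integral_add_of_mem_plans hξ (f.integrable μ) (g.integrable ν)
  rw [dualObjective_eq_coe hε hi, logDual, hval, hsum]
  simp only [Pi.smul_apply, smul_eq_mul, integral_const_mul]
  congr 1
  ring

lemma mul_logDual_le [IsProbabilityMeasure μ] [IsProbabilityMeasure ν] (hc : Measurable c)
    (hξ : ξ ∈ plans μ ν) (hε : 0 < ε) {D : ℝ}
    (hD : dualValue μ ν c ξ ε ≤ D) {h : X × Y → ℝ}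
    (hh : h ∈ LinearMap.range (potentialSum X Y)) :
    ε * logDual ξ (costMeasure c ξ ε) h ≤ D := by
  obtain ⟨⟨f, g⟩, rfl⟩ := hh
  have h1 := dualObjective_le_dualValue (μ := μ) (ν := ν) (c := c) (ξ := ξ) (ε := ε)
    (ε • f).toContinuousMap (ε • g).toContinuousMap ((ε • f).integrable μ) ((ε • g).integrable ν)
  have h2 := (dualObjective_smul hc hξ hε f g).symm.le.trans (h1.trans hD)
  exact_mod_cast h2

variable [HasOuterApproxClosed X] [HasOuterApproxClosed Y]

lemma mem_plans_of_forall_integral_eq (hξ : ξ ∈ plans μ ν) {π : Measure (X × Y)}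
    [IsFiniteMeasure π] (h : ∀ p, ∫ z, potentialSum X Y p z ∂π = ∫ z, potentialSum X Y p z ∂ξ) :
    π ∈ plans μ ν := by
  constructor
  · rw [← hξ.1]
    refine ext_of_forall_integral_eq_of_IsFiniteMeasure fun f => ?_
    rw [integral_map measurable_fst.aemeasurable f.continuous.measurable.aestronglyMeasurable,
      integral_map measurable_fst.aemeasurable f.continuous.measurable.aestronglyMeasurable]
    simpa [potentialSum] using h (f, 0)
  · rw [← hξ.2]
    refine ext_of_forall_integral_eq_of_IsFiniteMeasure fun f => ?_
    rw [integral_map measurable_snd.aemeasurable f.continuous.measurable.aestronglyMeasurable,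
      integral_map measurable_snd.aemeasurable f.continuous.measurable.aestronglyMeasurable]
    simpa [potentialSum] using h (0, f)

/-- If the dual value is finite, a dual maximizing sequence of bounded continuous potentials
recovers, in the limit, a plan whose cost is at most the dual value plus `ε`. -/
lemma exists_limit_plan [IsProbabilityMeasure μ] [IsProbabilityMeasure ν] (hc : Measurable c)
    (hξ : ξ ∈ plans μ ν) (hε : 0 < ε) {D : ℝ}
    (hD : dualValue μ ν c ξ ε ≤ D) :
    ∃ (ρ : X × Y → ℝ) (p : ℕ → (X →ᵇ ℝ) × (Y →ᵇ ℝ)) (K : ℝ), Measurable ρ ∧ (∀ z, 0 ≤ ρ z) ∧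
      Integrable ρ ξ ∧ ofDensity ξ ρ ∈ plans μ ν ∧
      primalObjective c ξ ε (ofDensity ξ ρ) ≤ ENNReal.ofReal (D + ε) ∧
      (∀ n, K ≤ logDual ξ (costMeasure c ξ ε) (potentialSum X Y (p n))) ∧
      ∀ᵐ z ∂ξ, Tendsto (fun n => Real.exp (potentialSum X Y (p n) z) * gibbsDensity c ε 0 0 z)
        atTop (𝓝 (ρ z)) := by
  have hfin := isFiniteMeasure_costMeasure (ξ := ξ) hc hε
  have hw := measurable_gibbsDensity_zero (ε := ε) hc
  have hw0 : ∀ z, 0 ≤ gibbsDensity c ε 0 0 z := fun z => (gibbsDensity_pos c ε 0 0 z).le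
  have hV := isTestSpace_potentialSum (X := X) (Y := Y)
  have hbdd : BddAbove (logDual ξ (costMeasure c ξ ε) '' LinearMap.range (potentialSum X Y)) := by
    refine ⟨D / ε, ?_⟩
    rintro _ ⟨h, hh, rfl⟩
    rw [le_div_iff₀ hε, mul_comm]
    exact mul_logDual_le hc hξ hε hD hh
  have hlub := isLUB_csSup (Set.Nonempty.image _ ⟨0, Submodule.zero_mem _⟩) hbdd
  set M := sSup (logDual ξ (costMeasure c ξ ε) '' LinearMap.range (potentialSum X Y))
  have hM : ∀ h ∈ LinearMap.range (potentialSum X Y), logDual ξ (costMeasure c ξ ε) h ≤ M :=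
    fun h hh => hlub.1 ⟨h, hh, rfl⟩
  have hMD : ε * M ≤ D := by
    rw [mul_comm, ← le_div_iff₀ hε]
    refine hlub.2 ?_
    rintro _ ⟨h, hh, rfl⟩
    rw [le_div_iff₀ hε, mul_comm]
    exact mul_logDual_le hc hξ hε hD hh
  obtain ⟨h, ρ, hhV, hh, hρm, hρ0, hρi, hlim, hL⟩ := exists_maximizing_sequence hV hlub
  have hδ : Tendsto (fun n : ℕ => ((1 : ℝ) / 4) ^ (n + 1)) atTop (𝓝 0) :=
    (tendsto_pow_atTop_nhds_zero_of_lt_one (by norm_num) (by norm_num)).comp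
      (tendsto_add_atTop_nat 1)
  have hmarg := fun k hk => integral_mul_limit_eq hV hM hδ hhV (fun n => (hh n).le) hρi hρ0 hL
    (k := k) hk
  have hkl := lintegral_klFun_limit_le hV hM hδ hhV (fun n => (hh n).le) hρm hρ0 hlim
  choose p hp using hhV
  have hm : Measurable (fun z => ρ z * gibbsDensity c ε 0 0 z) := hρm.mul hw
  have hm0 : ∀ z, 0 ≤ ρ z * gibbsDensity c ε 0 0 z := fun z => mul_nonneg (hρ0 z) (hw0 z)
  have hmi : Integrable (fun z => ρ z * gibbsDensity c ε 0 0 z) ξ :=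
    (integrable_ofDensity_iff hw hw0).1 hρi
  have hfinπ : IsFiniteMeasure (ofDensity ξ fun z => ρ z * gibbsDensity c ε 0 0 z) :=
    isFiniteMeasure_withDensity_ofReal hmi.2
  refine ⟨fun z => ρ z * gibbsDensity c ε 0 0 z, p, M - 1, hm, hm0, hmi, ?_, ?_, fun n => ?_, ?_⟩
  · refine mem_plans_of_forall_integral_eq hξ fun q => ?_
    rw [← hmarg _ ⟨q, rfl⟩, costMeasure, integral_ofDensity hw hw0, integral_ofDensity hm hm0]
    simp_rw [mul_assoc]
  · have h0M : 0 ≤ M + (costMeasure c ξ ε).real univ := by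
      have := hM 0 (Submodule.zero_mem _)
      simp [logDual] at this
      linarith
    have h1 := costMeasure_real_univ_le_one (ξ := ξ) hc hε
    rw [primalObjective_mul_gibbsDensity hc hε hρm hρ0 hρi]
    calc _ ≤ ENNReal.ofReal ε * (ENNReal.ofReal (M + (costMeasure c ξ ε).real univ) +
          ENNReal.ofReal (1 - (costMeasure c ξ ε).real univ)) := by gcongr
      _ = ENNReal.ofReal (ε * (M + 1)) := by
          rw [← ENNReal.ofReal_add h0M (sub_nonneg.2 h1), ← ENNReal.ofReal_mul hε.le]
          congr 1; ring
      _ ≤ ENNReal.ofReal (D + ε) := ENNReal.ofReal_le_ofReal (by linarith)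
  · rw [hp]
    have : ((1 : ℝ) / 4) ^ (n + 1) ≤ 1 := pow_le_one₀ (by norm_num) (by norm_num)
    linarith [hh n]
  · have := (ae_withDensity_iff hw.ennreal_ofReal).1 hlim
    filter_upwards [this] with z hz
    simp_rw [hp]
    exact (hz (by simpa using gibbsDensity_pos c ε 0 0 z)).mul_const _

end Existence

/-! ### Strong duality, uniqueness and recovery -/

section Duality

variable {X Y : Type*} [TopologicalSpace X] [MeasurableSpace X]
  [TopologicalSpace Y] [MeasurableSpace Y] {μ : Measure X} {ν : Measure Y}
  {c : X × Y → ℝ≥0} {ξ : Measure (X × Y)} {ε : ℝ}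

lemma dualValue_add_le [IsProbabilityMeasure μ] [IsProbabilityMeasure ξ] (hc : Measurable c)
    (hξ : ξ ∈ plans μ ν) (hε : 0 < ε) {π : Measure (X × Y)} (hπ : π ∈ plans μ ν) :
    dualValue μ ν c ξ ε + (ε : EReal) ≤ (primalObjective c ξ ε π : EReal) := by
  have := isProbabilityMeasure_of_mem_plans hπ
  rw [← EReal.le_sub_iff_add_le (Or.inl (EReal.coe_ne_bot _)) (Or.inl (EReal.coe_ne_top _))]
  refine iSup_le fun f => iSup_le fun g => iSup_le fun hf => iSup_le fun hg => ?_
  rw [EReal.le_sub_iff_add_le (Or.inl (EReal.coe_ne_bot _)) (Or.inl (EReal.coe_ne_top _))]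
  exact dualObjective_add_le hc hξ hε hπ hf hg

lemma dualValue_ne_top [IsProbabilityMeasure μ] [IsProbabilityMeasure ξ] (hc : Measurable c)
    (hξ : ξ ∈ plans μ ν) (hε : 0 < ε) (hcξ : ∫⁻ z, (c z : ℝ≥0∞) ∂ξ ≠ ⊤) :
    dualValue μ ν c ξ ε ≠ ⊤ := by
  intro htop
  have h := dualValue_add_le hc hξ hε hξ
  rw [htop, EReal.top_add_coe, primalObjective, klDiv_self, mul_zero, add_zero, top_le_iff,
    EReal.coe_ennreal_eq_top_iff] at h
  exact hcξ h

lemma exists_dualObjective_gt (hc : Measurable c) (hξ : ξ ∈ plans μ ν) (hε : 0 < ε) {D : ℝ}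
    (hD : dualValue μ ν c ξ ε = D) {η : ℝ} (hη : 0 < η) :
    ∃ (f : X → ℝ) (g : Y → ℝ), Integrable f μ ∧ Integrable g ν ∧
      Integrable (gibbsDensity c ε f g) ξ ∧
      D - η < ∫ x, f x ∂μ + ∫ y, g y ∂ν - ε * ∫ z, gibbsDensity c ε f g z ∂ξ := by
  have h : ((D - η : ℝ) : EReal) < dualValue μ ν c ξ ε := by
    rw [hD]
    exact_mod_cast sub_lt_self D hη
  simp only [dualValue, lt_iSup_iff] at h
  obtain ⟨f, g, hf, hg, h⟩ := h
  by_cases hi : Integrable (gibbsDensity c ε f g) ξ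
  · rw [dualObjective_eq_coe hε hi] at h
    exact ⟨f, g, hf, hg, hi, by exact_mod_cast h⟩
  · rw [dualObjective_eq_bot hc hξ hε hf hg hi] at h
    exact absurd h not_lt_bot

variable [BorelSpace X] [BorelSpace Y] [IsProbabilityMeasure μ] [IsProbabilityMeasure ν]
  [IsProbabilityMeasure ξ]

/-- The zero potentials show that the dual value is at least `-ε`. -/
lemma neg_le_of_dualValue_le (hc : Measurable c) (hξ : ξ ∈ plans μ ν) (hε : 0 < ε) {D : ℝ}
    (hD : dualValue μ ν c ξ ε ≤ D) : -ε ≤ D := by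
  have h1 := mul_logDual_le hc hξ hε hD (Submodule.zero_mem _)
  have h2 := costMeasure_real_univ_le_one (ξ := ξ) hc hε
  simp [logDual] at h1
  nlinarith

lemma dualValue_eq_top_or_coe (hc : Measurable c) (hξ : ξ ∈ plans μ ν) (hε : 0 < ε) :
    dualValue μ ν c ξ ε = ⊤ ∨ ∃ D : ℝ, dualValue μ ν c ξ ε = D := by
  by_cases htop : dualValue μ ν c ξ ε = ⊤
  · exact Or.inl htop
  · refine Or.inr ⟨_, (EReal.coe_toReal htop fun hbot => ?_).symm⟩
    have := neg_le_of_dualValue_le (D := -ε - 1) hc hξ hε (hbot.le.trans bot_le)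
    linarith

/-- Two plans without duality gap are both close, in Hellinger distance, to the plans recovered
from almost optimal potentials, so they agree. -/
lemma eq_of_primalObjective_eq (hc : Measurable c) (hξ : ξ ∈ plans μ ν) (hε : 0 < ε) {D : ℝ}
    (hD : dualValue μ ν c ξ ε = D) {π₁ π₂ : Measure (X × Y)} (h₁ : π₁ ∈ plans μ ν)
    (h₂ : π₂ ∈ plans μ ν)
    (e₁ : primalObjective c ξ ε π₁ = ENNReal.ofReal (D + ε))
    (e₂ : primalObjective c ξ ε π₂ = ENNReal.ofReal (D + ε)) : π₁ = π₂ := by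
  have := isProbabilityMeasure_of_mem_plans h₁
  have := isProbabilityMeasure_of_mem_plans h₂
  have hDε : 0 ≤ D + ε := by linarith [neg_le_of_dualValue_le hc hξ hε hD.le]
  have t₁ : primalObjective c ξ ε π₁ ≠ ∞ := by rw [e₁]; exact ENNReal.ofReal_ne_top
  have t₂ : primalObjective c ξ ε π₂ ≠ ∞ := by rw [e₂]; exact ENNReal.ofReal_ne_top
  obtain ⟨ρ₁, m₁, n₁, i₁, rfl⟩ := exists_density hε t₁
  obtain ⟨ρ₂, m₂, n₂, i₂, rfl⟩ := exists_density hε t₂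
  have key : ∀ η > 0, Integrable (fun z => (√(ρ₁ z) - √(ρ₂ z)) ^ 2) ξ ∧
      ε * ∫ z, (√(ρ₁ z) - √(ρ₂ z)) ^ 2 ∂ξ ≤ 4 * η := by
    intro η hη
    obtain ⟨f, g, hf, hg, hi, hlt⟩ := exists_dualObjective_gt hc hξ hε hD hη
    obtain ⟨j₁, l₁⟩ := dual_add_hellinger_le hc hε m₁ n₁ i₁ h₁ t₁ hf hg hi
    obtain ⟨j₂, l₂⟩ := dual_add_hellinger_le hc hε m₂ n₂ i₂ h₂ t₂ hf hg hi
    rw [e₁, ENNReal.toReal_ofReal hDε] at l₁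
    rw [e₂, ENNReal.toReal_ofReal hDε] at l₂
    have hle : ∀ z, (√(ρ₁ z) - √(ρ₂ z)) ^ 2 ≤ 2 * (√(ρ₁ z) - √(gibbsDensity c ε f g z)) ^ 2 +
        2 * (√(ρ₂ z) - √(gibbsDensity c ε f g z)) ^ 2 := fun z => by
      nlinarith [sq_nonneg (√(ρ₁ z) + √(ρ₂ z) - 2 * √(gibbsDensity c ε f g z))]
    have j := (j₁.const_mul 2).add (j₂.const_mul 2)
    have j₀ : Integrable (fun z => (√(ρ₁ z) - √(ρ₂ z)) ^ 2) ξ := by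
      refine j.mono' ((m₁.sqrt.sub m₂.sqrt).pow_const 2).aestronglyMeasurable
        (ae_of_all _ fun z => ?_)
      rw [Real.norm_of_nonneg (sq_nonneg _)]
      exact hle z
    refine ⟨j₀, ?_⟩
    have h := integral_mono j₀ j hle
    simp only [Pi.add_apply] at h
    rw [integral_add (j₁.const_mul 2) (j₂.const_mul 2), integral_const_mul,
      integral_const_mul] at h
    have := mul_le_mul_of_nonneg_left h hε.le
    linarith
  have h0 : ∫ z, (√(ρ₁ z) - √(ρ₂ z)) ^ 2 ∂ξ = 0 := by
    refine le_antisymm (le_of_forall_pos_le_add fun η hη => ?_)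
      (integral_nonneg fun z => sq_nonneg _)
    have := (key (ε * η / 4) (by positivity)).2
    rw [zero_add]
    refine le_of_mul_le_mul_left ?_ hε
    linarith
  rw [integral_eq_zero_iff_of_nonneg (fun z => sq_nonneg _) (key 1 one_pos).1] at h0
  refine withDensity_congr_ae ?_
  filter_upwards [h0] with z hz
  have := sub_eq_zero.1 (pow_eq_zero_iff two_ne_zero |>.1 hz)
  rw [(Real.sqrt_inj (n₁ z) (n₂ z)).1 this]

/-- A plan without duality gap is recovered from any pair of optimal potentials. -/
lemma eq_recoveredPlan (hc : Measurable c) (hξ : ξ ∈ plans μ ν) (hε : 0 < ε) {f : X → ℝ}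
    {g : Y → ℝ} (hfg : IsOptimalDualPair μ ν c ξ ε f g) {π : Measure (X × Y)}
    (hπ : π ∈ plans μ ν)
    (e : (primalObjective c ξ ε π : EReal) = dualValue μ ν c ξ ε + (ε : EReal)) :
    π = recoveredPlan c ξ ε f g := by
  have := isProbabilityMeasure_of_mem_plans hπ
  obtain ⟨hf, hg, hval⟩ := hfg
  have hi : Integrable (gibbsDensity c ε f g) ξ := by
    by_contra hi
    rw [dualObjective_eq_bot hc hξ hε hf hg hi] at hval
    rcases dualValue_eq_top_or_coe hc hξ hε with h | ⟨D, h⟩ <;> rw [h] at hval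
    · exact bot_ne_top hval
    · exact EReal.bot_ne_coe _ hval
  rw [← hval, dualObjective_eq_coe hε hi] at e
  have ht : primalObjective c ξ ε π ≠ ∞ := fun h => by
    rw [h] at e
    exact EReal.coe_ne_top _ (e.symm.trans rfl)
  obtain ⟨ρ, m, n, i, rfl⟩ := exists_density hε ht
  obtain ⟨j, l⟩ := dual_add_hellinger_le hc hε m n i hπ ht hf hg hi
  rw [← EReal.coe_ennreal_toReal ht] at e
  have e' : (primalObjective c ξ ε (ofDensity ξ ρ)).toReal =
      ∫ x, f x ∂μ + ∫ y, g y ∂ν - ε * ∫ z, gibbsDensity c ε f g z ∂ξ + ε := by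
    exact_mod_cast e
  have h0 : ∫ z, (√(ρ z) - √(gibbsDensity c ε f g z)) ^ 2 ∂ξ = 0 := by
    refine le_antisymm ?_ (integral_nonneg fun z => sq_nonneg _)
    refine le_of_mul_le_mul_left ?_ hε
    linarith
  rw [integral_eq_zero_iff_of_nonneg (fun z => sq_nonneg _) j] at h0
  refine withDensity_congr_ae ?_
  filter_upwards [h0] with z hz
  have := sub_eq_zero.1 (pow_eq_zero_iff two_ne_zero |>.1 hz)
  rw [(Real.sqrt_inj (n z) (gibbsDensity_pos c ε f g z).le).1 this]
  rfl

variable [HasOuterApproxClosed X] [HasOuterApproxClosed Y]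

/-- Strong duality: some plan has no duality gap. -/
lemma exists_plan_eq_dualValue_add (hc : Measurable c) (hξ : ξ ∈ plans μ ν) (hε : 0 < ε) :
    ∃ π ∈ plans μ ν,
      (primalObjective c ξ ε π : EReal) = dualValue μ ν c ξ ε + (ε : EReal) := by
  rcases dualValue_eq_top_or_coe hc hξ hε with htop | ⟨D, hD⟩
  · refine ⟨ξ, hξ, le_antisymm ?_ (dualValue_add_le hc hξ hε hξ)⟩
    rw [htop, EReal.top_add_coe]
    exact le_top
  · obtain ⟨ρ, -, -, -, -, -, hπ, hle, -⟩ := exists_limit_plan hc hξ hε hD.le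
    have hDε : 0 ≤ D + ε := by linarith [neg_le_of_dualValue_le hc hξ hε hD.le]
    refine ⟨_, hπ, le_antisymm ?_ (dualValue_add_le hc hξ hε hπ)⟩
    rw [hD]
    refine (EReal.coe_ennreal_le_coe_ennreal_iff.2 hle).trans_eq ?_
    rw [EReal.coe_ennreal_ofReal, max_eq_left hDε, EReal.coe_add]

lemma primalValue_eq_dualValue_add (hc : Measurable c) (hξ : ξ ∈ plans μ ν) (hε : 0 < ε) :
    (primalValue μ ν c ξ ε : EReal) = dualValue μ ν c ξ ε + (ε : EReal) := by
  obtain ⟨π, hπ, e⟩ := exists_plan_eq_dualValue_add hc hξ hε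
  have h : primalValue μ ν c ξ ε = primalObjective c ξ ε π := by
    refine le_antisymm (iInf₂_le π hπ) (le_iInf₂ fun π' hπ' => ?_)
    rw [← EReal.coe_ennreal_le_coe_ennreal_iff, e]
    exact dualValue_add_le hc hξ hε hπ'
  rw [h, e]

lemma isOptimalPlan_iff (hc : Measurable c) (hξ : ξ ∈ plans μ ν) (hε : 0 < ε)
    {π : Measure (X × Y)} : IsOptimalPlan μ ν c ξ ε π ↔
      π ∈ plans μ ν ∧
        (primalObjective c ξ ε π : EReal) = dualValue μ ν c ξ ε + (ε : EReal) := by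
  constructor
  · rintro ⟨hπ, hmin⟩
    obtain ⟨π₀, hπ₀, e⟩ := exists_plan_eq_dualValue_add hc hξ hε
    refine ⟨hπ, le_antisymm ?_ (dualValue_add_le hc hξ hε hπ)⟩
    rw [← e]
    exact EReal.coe_ennreal_le_coe_ennreal_iff.2 (hmin π₀ hπ₀)
  · rintro ⟨hπ, e⟩
    refine ⟨hπ, fun π' hπ' => ?_⟩
    rw [← EReal.coe_ennreal_le_coe_ennreal_iff, e]
    exact dualValue_add_le hc hξ hε hπ'

lemma existsUnique_isOptimalPlan (hc : Measurable c) (hξ : ξ ∈ plans μ ν) (hε : 0 < ε)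
    (hP : primalValue μ ν c ξ ε ≠ ⊤) : ∃! π, IsOptimalPlan μ ν c ξ ε π := by
  obtain ⟨π, hπ, e⟩ := exists_plan_eq_dualValue_add hc hξ hε
  refine ⟨π, (isOptimalPlan_iff hc hξ hε).2 ⟨hπ, e⟩, fun π' h' => ?_⟩
  obtain ⟨hπ', e'⟩ := (isOptimalPlan_iff hc hξ hε).1 h'
  rcases dualValue_eq_top_or_coe hc hξ hε with htop | ⟨D, hD⟩
  · have := primalValue_eq_dualValue_add hc hξ hε
    rw [htop, EReal.top_add_coe] at this
    exact absurd (EReal.coe_ennreal_eq_top_iff.1 this) hP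
  · have hDε : 0 ≤ D + ε := by linarith [neg_le_of_dualValue_le hc hξ hε hD.le]
    have h : ((ENNReal.ofReal (D + ε) : ℝ≥0∞) : EReal) = dualValue μ ν c ξ ε + (ε : EReal) := by
      rw [hD, EReal.coe_ennreal_ofReal, max_eq_left hDε, EReal.coe_add]
    rw [← h, EReal.coe_ennreal_eq_coe_ennreal_iff] at e e'
    exact eq_of_primalObjective_eq hc hξ hε hD hπ' hπ e' e

lemma isOptimalPlan_iff_eq_recoveredPlan (hc : Measurable c) (hξ : ξ ∈ plans μ ν) (hε : 0 < ε)
    {f : X → ℝ} {g : Y → ℝ} (hfg : IsOptimalDualPair μ ν c ξ ε f g) (π : Measure (X × Y)) :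
    IsOptimalPlan μ ν c ξ ε π ↔ π = recoveredPlan c ξ ε f g := by
  constructor
  · intro h
    obtain ⟨hπ, e⟩ := (isOptimalPlan_iff hc hξ hε).1 h
    exact eq_recoveredPlan hc hξ hε hfg hπ e
  · rintro rfl
    obtain ⟨π, hπ, e⟩ := exists_plan_eq_dualValue_add hc hξ hε
    rw [isOptimalPlan_iff hc hξ hε, ← eq_recoveredPlan hc hξ hε hfg hπ e]
    exact ⟨hπ, e⟩

lemma dualObjective_le_dualValue_of_integrable (hc : Measurable c) (hξ : ξ ∈ plans μ ν)
    (hε : 0 < ε) {f : X → ℝ} {g : Y → ℝ} (hf : Integrable f μ) (hg : Integrable g ν) :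
    dualObjective μ ν c ξ ε f g ≤ dualValue μ ν c ξ ε := by
  obtain ⟨π, hπ, e⟩ := exists_plan_eq_dualValue_add hc hξ hε
  have := isProbabilityMeasure_of_mem_plans hπ
  have h := dualObjective_add_le hc hξ hε hπ hf hg
  rw [e] at h
  exact (EReal.addLECancellable_coe ε).add_le_add_iff_right.1 h

end Duality

/-! ### Attainment of the dual maximum -/

section Attainment

variable {X Y : Type*} [MeasurableSpace X] [MeasurableSpace Y]
  {μ : Measure X} [IsProbabilityMeasure μ] {ν : Measure Y} [IsProbabilityMeasure ν]

/-- If `f n ⊕ g n` converges almost everywhere for the product measure, then, after moving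
constants from `g n` to `f n`, the two summands converge separately. The limits are integrable if
the limit of the sums is. -/
lemma exists_separate_limits {f : ℕ → X → ℝ} {g : ℕ → Y → ℝ} (hf : ∀ n, Measurable (f n))
    (hg : ∀ n, Measurable (g n)) {φ : X × Y → ℝ} (hφ : Integrable φ (μ.prod ν))
    (hlim : ∀ᵐ z ∂(μ.prod ν), Tendsto (fun n => f n z.1 + g n z.2) atTop (𝓝 (φ z))) :
    ∃ (F : X → ℝ) (G : Y → ℝ) (b : ℕ → ℝ), Measurable F ∧ Measurable G ∧ Integrable F μ ∧
      Integrable G ν ∧ (∀ᵐ x ∂μ, Tendsto (fun n => f n x + b n) atTop (𝓝 (F x))) ∧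
      ∀ᵐ y ∂ν, Tendsto (fun n => g n y - b n) atTop (𝓝 (G y)) := by
  have hxy := Measure.ae_ae_of_ae_prod hlim
  have hyx : ∀ᵐ y ∂ν, ∀ᵐ x ∂μ, Tendsto (fun n => f n x + g n y) atTop (𝓝 (φ (x, y))) :=
    Measure.ae_ae_of_ae_prod
      ((Measure.measurePreserving_swap (μ := ν) (ν := μ)).quasiMeasurePreserving.ae hlim)
  obtain ⟨y₀, hy₀⟩ := hyx.exists
  obtain ⟨x₀, hx₀, hx₀y₀⟩ := (hxy.and hy₀).exists
  have h1 : ∀ᵐ x ∂μ, ∃ l, Tendsto (fun n => f n x + g n y₀) atTop (𝓝 l) := by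
    filter_upwards [hy₀] with x hx using ⟨_, hx⟩
  have h2 : ∀ᵐ y ∂ν, ∃ l, Tendsto (fun n => g n y - g n y₀) atTop (𝓝 l) := by
    filter_upwards [hx₀] with y hy
    refine ⟨_, (hy.sub hx₀y₀).congr fun n => ?_⟩
    ring
  obtain ⟨F, hFm, hF⟩ := exists_stronglyMeasurable_limit_of_tendsto_ae
    (fun n => ((hf n).add_const _).aestronglyMeasurable) h1
  obtain ⟨G, hGm, hG⟩ := exists_stronglyMeasurable_limit_of_tendsto_ae
    (fun n => ((hg n).sub_const _).aestronglyMeasurable) h2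
  have hsum : φ =ᵐ[μ.prod ν] fun z => F z.1 + G z.2 := by
    filter_upwards [hlim, Measure.quasiMeasurePreserving_fst.ae hF,
      Measure.quasiMeasurePreserving_snd.ae hG] with z h hFz hGz
    refine tendsto_nhds_unique h ((hFz.add hGz).congr fun n => ?_)
    ring
  have hint := hφ.congr hsum
  obtain ⟨y₁, hy₁⟩ := hint.prod_left_ae.exists
  obtain ⟨x₁, hx₁⟩ := hint.prod_right_ae.exists
  refine ⟨F, G, fun n => g n y₀, hFm.measurable, hGm.measurable, ?_, ?_, hF, hG⟩
  · exact (hy₁.sub (integrable_const (G y₁))).congr (ae_of_all _ fun x => add_sub_cancel_right _ _)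
  · exact (hx₁.sub (integrable_const (F x₁))).congr (ae_of_all _ fun y => add_sub_cancel_left _ _)

variable [TopologicalSpace X] [BorelSpace X] [TopologicalSpace Y] [BorelSpace Y]
  [HasOuterApproxClosed X] [HasOuterApproxClosed Y]
  {c : X × Y → ℝ≥0} {ξ : Measure (X × Y)} [IsProbabilityMeasure ξ] {ε : ℝ}

/-- If the cost is integrable, the sums of a maximizing sequence of potentials converge, almost
everywhere for `ξ`, to the logarithm of the density of a plan. -/
lemma exists_limit_of_potentials (hc : Measurable c) (hξ : ξ ∈ plans μ ν) (hε : 0 < ε)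
    (hcξ : ∫⁻ z, (c z : ℝ≥0∞) ∂ξ ≠ ⊤) :
    ∃ (p : ℕ → (X →ᵇ ℝ) × (Y →ᵇ ℝ)) (φ : X × Y → ℝ), Integrable φ ξ ∧
      (∀ᵐ z ∂ξ, Tendsto (fun n => potentialSum X Y (p n) z) atTop (𝓝 (φ z))) ∧
      ofDensity ξ (fun z => Real.exp (φ z) * gibbsDensity c ε 0 0 z) ∈ plans μ ν := by
  obtain ⟨D, hD⟩ := (dualValue_eq_top_or_coe hc hξ hε).resolve_left
    (dualValue_ne_top hc hξ hε hcξ)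
  obtain ⟨ρ, p, K, hρm, hρ0, hρi, hπ, -, hK, hlim⟩ := exists_limit_plan hc hξ hε hD.le
  have hfin := isFiniteMeasure_costMeasure (ξ := ξ) hc hε
  have hw := measurable_gibbsDensity_zero (ε := ε) hc
  have hw0 : ∀ z, 0 ≤ gibbsDensity c ε 0 0 z := fun z => (gibbsDensity_pos c ε 0 0 z).le
  have hV := isTestSpace_potentialSum (X := X) (Y := Y)
  have hmem : ∀ n, potentialSum X Y (p n) ∈ LinearMap.range (potentialSum X Y) :=
    fun n => LinearMap.mem_range_self _ _
  have hci : Integrable (fun z => (c z : ℝ)) ξ := by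
    refine (lintegral_ofReal_ne_top_iff_integrable hc.coe_nnreal_real.aestronglyMeasurable
      (ae_of_all _ fun z => (c z).coe_nonneg)).1 ?_
    simpa using hcξ
  have hexp : ∀ n z, Real.exp (potentialSum X Y (p n) z - c z / ε) =
      Real.exp (potentialSum X Y (p n) z) * gibbsDensity c ε 0 0 z := fun n z => by
    rw [gibbsDensity, ← Real.exp_add]
    congr 1
    simp only [Pi.zero_apply]
    ring
  have hint : ∀ n, Integrable (fun z => potentialSum X Y (p n) z - c z / ε) ξ := fun n =>
    (hV.integrable (hmem n)).sub (hci.div_const ε)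
  have hinte : ∀ n, Integrable (fun z => Real.exp (potentialSum X Y (p n) z - c z / ε)) ξ :=
    fun n => by
      simp_rw [hexp]
      exact (integrable_ofDensity_iff hw hw0).1
        (hV.integrable_exp (τ := costMeasure c ξ ε) (hmem n))
  obtain ⟨hae, hlog⟩ := tendsto_log_of_integral_sub_exp_ge (ξ := ξ) (ρ := ρ)
    (s := fun n z => potentialSum X Y (p n) z - c z / ε)
    (fun n => (hV.measurable _ (hmem n)).sub (hc.coe_nnreal_real.div_const ε)) hint hinte
    (K := K - ∫ z, c z / ε ∂ξ) (fun n => by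
      have h := hK n
      rw [logDual, costMeasure, integral_ofDensity hw hw0] at h
      simp_rw [hexp]
      rw [integral_sub (hV.integrable (hmem n)) (hci.div_const ε)]
      linarith) hρm hρ0 hρi (by
      filter_upwards [hlim] with z hz
      simp_rw [hexp]
      exact hz)
  refine ⟨p, fun z => Real.log (ρ z) + c z / ε, hlog.add (hci.div_const ε), ?_, ?_⟩
  · filter_upwards [hae] with z hz
    refine (hz.2.add_const (c z / ε)).congr fun n => ?_
    ring
  · have : ofDensity ξ (fun z => Real.exp (Real.log (ρ z) + c z / ε) * gibbsDensity c ε 0 0 z) =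
        ofDensity ξ ρ := by
      refine withDensity_congr_ae ?_
      filter_upwards [hae] with z hz
      rw [gibbsDensity, ← Real.exp_add]
      conv_rhs => rw [← Real.exp_log hz.1]
      congr 2
      simp only [Pi.zero_apply]
      ring
    rwa [this]

/-- Potentials whose sum is the logarithm of the density of a plan, up to the cost, are optimal. -/
lemma isOptimalDualPair_of_ae_eq (hc : Measurable c) (hξ : ξ ∈ plans μ ν) (hε : 0 < ε)
    {φ : X × Y → ℝ}
    (hπ : ofDensity ξ (fun z => Real.exp (φ z) * gibbsDensity c ε 0 0 z) ∈ plans μ ν)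
    {F : X → ℝ} {G : Y → ℝ} (hFm : Measurable F) (hGm : Measurable G) (hF : Integrable F μ)
    (hG : Integrable G ν) (h : ∀ᵐ z ∂ξ, F z.1 + G z.2 = φ z) :
    IsOptimalDualPair μ ν c ξ ε (ε • F) (ε • G) := by
  have e : ofDensity ξ (fun z => Real.exp (φ z) * gibbsDensity c ε 0 0 z) =
      recoveredPlan c ξ ε (ε • F) (ε • G) := by
    refine withDensity_congr_ae ?_
    filter_upwards [h] with z hz
    show _ = ENNReal.ofReal (gibbsDensity c ε (ε • F) (ε • G) z)
    rw [gibbsDensity_smul hε, hz]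
  rw [e] at hπ
  have h1 := dualObjective_add_eq_of_mem_plans hc hε (hFm.const_smul ε) (hGm.const_smul ε)
    (hF.smul ε) (hG.smul ε) hπ
  have h2 := dualValue_add_le hc hξ hε hπ
  rw [← h1] at h2
  exact ⟨hF.smul ε, hG.smul ε, le_antisymm
    (dualObjective_le_dualValue_of_integrable hc hξ hε (hF.smul ε) (hG.smul ε))
    ((EReal.addLECancellable_coe ε).add_le_add_iff_right.1 h2)⟩

/-- Attainment by integrable potentials if the reference plan dominates a multiple of the product
measure. -/
lemma exists_isOptimalDualPair_of_le (hc : Measurable c) (hξ : ξ ∈ plans μ ν) (hε : 0 < ε)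
    (hcξ : ∫⁻ z, (c z : ℝ≥0∞) ∂ξ ≠ ⊤) {t : ℝ≥0∞} (ht : t ≠ 0) (htop : t ≠ ⊤)
    (hle : t • μ.prod ν ≤ ξ) :
    ∃ f g, Measurable f ∧ Measurable g ∧ IsOptimalDualPair μ ν c ξ ε f g := by
  obtain ⟨p, φ, hφ, hlim, hπ⟩ := exists_limit_of_potentials hc hξ hε hcξ
  have hac : μ.prod ν ≪ ξ :=
    (Measure.absolutelyContinuous_smul ht).trans hle.absolutelyContinuous
  obtain ⟨F, G, b, hFm, hGm, hF, hG, hFl, hGl⟩ := exists_separate_limits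
    (fun n => (p n).1.continuous.measurable) (fun n => (p n).2.continuous.measurable)
    ((integrable_smul_measure ht htop).1 (hφ.mono_measure hle)) (hac.ae_le hlim)
  refine ⟨ε • F, ε • G, hFm.const_smul ε, hGm.const_smul ε,
    isOptimalDualPair_of_ae_eq hc hξ hε hπ hFm hGm hF hG ?_⟩
  rw [← hξ.1] at hFl
  rw [← hξ.2] at hGl
  filter_upwards [hlim, ae_of_ae_map measurable_fst.aemeasurable hFl,
    ae_of_ae_map measurable_snd.aemeasurable hGl] with z hz h1 h2
  refine tendsto_nhds_unique ((h1.add h2).congr fun n => ?_) hz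
  simp only [potentialSum, LinearMap.coe_mk, AddHom.coe_mk]
  ring

/-- Attainment by continuous potentials if the marginals are finitely supported: the sums
`f ⊕ g` form a finite-dimensional, hence closed, space of functions on the support. -/
lemma exists_continuous_isOptimalDualPair_of_finite (hc : Measurable c) (hξ : ξ ∈ plans μ ν)
    (hε : 0 < ε) {S : Set X} {T : Set Y} (hS : S.Finite) (hT : T.Finite) (hμ : μ Sᶜ = 0)
    (hν : ν Tᶜ = 0) : ∃ (f : C(X, ℝ)) (g : C(Y, ℝ)), IsOptimalDualPair μ ν c ξ ε f g := by
  have hST : ∀ᵐ z ∂ξ, z ∈ S ×ˢ T := by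
    have h1 : ∀ᵐ x ∂(ξ.map Prod.fst), x ∈ S := by rw [hξ.1]; exact hμ
    have h2 : ∀ᵐ y ∂(ξ.map Prod.snd), y ∈ T := by rw [hξ.2]; exact hν
    filter_upwards [ae_of_ae_map measurable_fst.aemeasurable h1,
      ae_of_ae_map measurable_snd.aemeasurable h2] with z hz1 hz2 using ⟨hz1, hz2⟩
  have hcξ : ∫⁻ z, (c z : ℝ≥0∞) ∂ξ ≠ ⊤ := by
    obtain ⟨B, hB⟩ := ((hS.prod hT).image c).bddAbove
    refine ne_top_of_le_ne_top (ENNReal.coe_ne_top (r := B)) ?_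
    calc ∫⁻ z, (c z : ℝ≥0∞) ∂ξ ≤ ∫⁻ _, (B : ℝ≥0∞) ∂ξ := by
          refine lintegral_mono_ae ?_
          filter_upwards [hST] with z hz
          exact_mod_cast hB (mem_image_of_mem c hz)
      _ = B := by simp
  obtain ⟨p, φ, -, hlim, hπ⟩ := exists_limit_of_potentials hc hξ hε hcξ
  let E : Set (X × Y) :=
    {z ∈ S ×ˢ T | Tendsto (fun n => potentialSum X Y (p n) z) atTop (𝓝 (φ z))}
  have : Finite E := ((hS.prod hT).subset (sep_subset _ _)).to_subtype
  let L : ((X →ᵇ ℝ) × (Y →ᵇ ℝ)) →ₗ[ℝ] (E → ℝ) :=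
    (LinearMap.funLeft ℝ ℝ (Subtype.val : E → X × Y)).comp (potentialSum X Y)
  have hclosed : IsClosed (LinearMap.range L : Set (E → ℝ)) :=
    (LinearMap.range L).closed_of_finiteDimensional
  have htend : Tendsto (fun n => L (p n)) atTop (𝓝 fun z : E => φ z) :=
    tendsto_pi_nhds.2 fun z => z.2.2
  obtain ⟨⟨f, g⟩, hfg⟩ := hclosed.mem_of_tendsto htend
    (Eventually.of_forall fun n => LinearMap.mem_range_self L (p n))
  refine ⟨(ε • f).toContinuousMap, (ε • g).toContinuousMap,
    isOptimalDualPair_of_ae_eq hc hξ hε hπ f.continuous.measurable g.continuous.measurable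
      (f.integrable μ) (g.integrable ν) ?_⟩
  filter_upwards [hST, hlim] with z hz1 hz2
  exact congrFun hfg ⟨z, hz1, hz2⟩

end Attainment

end SROT

theorem theorem1 {X Y Θ : Type*}
    [TopologicalSpace X] [PolishSpace X] [MeasurableSpace X] [BorelSpace X] [Nonempty X]
    [TopologicalSpace Y] [PolishSpace Y] [MeasurableSpace Y] [BorelSpace Y] [Nonempty Y]
    [MeasurableSpace Θ]
    (μ : Measure X) [IsProbabilityMeasure μ] (ν : Measure Y) [IsProbabilityMeasure ν]
    (c : X × Y → ℝ≥0) (hc : Measurable c)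
    (σ : Measure Θ) [IsProbabilityMeasure σ]
    (p : Θ → X → ℝ) (hp : Measurable (fun z : Θ × X => p z.1 z.2))
    (q : Θ → Y → ℝ) (hq : Measurable (fun z : Θ × Y => q z.1 z.2))
    (γ : ℝ) (hγ : γ ∈ Icc (0 : ℝ) 1) (ε : ℝ) (hε : 0 < ε)
    (ξ : Measure (X × Y)) (hξ : ξ = SROT.smoothedSOTPlan μ ν σ p q γ) :
    -- strong duality
    (SROT.primalValue μ ν c ξ ε : EReal) = SROT.dualValue μ ν c ξ ε + (ε : EReal) ∧
    -- the primal minimum is attained, at a unique plan if it is finite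
    (∃ π, SROT.IsOptimalPlan μ ν c ξ ε π) ∧
    (SROT.primalValue μ ν c ξ ε ≠ ⊤ → ∃! π, SROT.IsOptimalPlan μ ν c ξ ε π) ∧
    -- recovery of the optimal plan from optimal dual potentials
    (∀ f g, SROT.IsOptimalDualPair μ ν c ξ ε f g →
      ∀ π, SROT.IsOptimalPlan μ ν c ξ ε π ↔ π = SROT.recoveredPlan c ξ ε f g) ∧
    -- passing from continuous to integrable potentials does not raise the dual value
    (∀ f g, Integrable f μ → Integrable g ν →
      SROT.dualObjective μ ν c ξ ε f g ≤ SROT.dualValue μ ν c ξ ε) ∧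
    -- with smoothing, the dual maximum is attained by integrable potentials
    (0 < γ → ∫⁻ z, (c z : ℝ≥0∞) ∂ξ ≠ ⊤ →
      ∃ f g, Measurable f ∧ Measurable g ∧ SROT.IsOptimalDualPair μ ν c ξ ε f g) ∧
    -- for discrete `μ` and `ν`, it is attained by continuous potentials, even without smoothing
    (∀ (S : Set X) (T : Set Y), S.Finite → T.Finite → μ Sᶜ = 0 → ν Tᶜ = 0 →
      ∃ (f : C(X, ℝ)) (g : C(Y, ℝ)), SROT.IsOptimalDualPair μ ν c ξ ε f g) := by
  have hξp : ξ ∈ SROT.plans μ ν := by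
    rw [hξ]
    exact SROT.smoothedSOTPlan_mem_plans μ ν hp hq hγ
  have : IsProbabilityMeasure ξ := SROT.isProbabilityMeasure_of_mem_plans hξp
  refine ⟨SROT.primalValue_eq_dualValue_add hc hξp hε, ?_,
    SROT.existsUnique_isOptimalPlan hc hξp hε,
    fun f g hfg => SROT.isOptimalPlan_iff_eq_recoveredPlan hc hξp hε hfg,
    fun f g hf hg => SROT.dualObjective_le_dualValue_of_integrable hc hξp hε hf hg,
    fun hγ0 hcξ => ?_,
    fun S T hS hT hμ hν => SROT.exists_continuous_isOptimalDualPair_of_finite hc hξp hε hS hT hμ hν⟩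
  · obtain ⟨π, hπ, e⟩ := SROT.exists_plan_eq_dualValue_add hc hξp hε
    exact ⟨π, (SROT.isOptimalPlan_iff hc hξp hε).2 ⟨hπ, e⟩⟩
  · refine SROT.exists_isOptimalDualPair_of_le hc hξp hε hcξ (t := ENNReal.ofReal γ)
      (by simpa using hγ0) ENNReal.ofReal_ne_top ?_
    rw [hξ, SROT.smoothedSOTPlan]
    exact Measure.le_add_left le_rfl
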